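/- There is an absolute constant $K>0$ such that the following holds. Let $m,N\ge 1$ be integers with $m\mid N$, and let $C_m\in GL_N(\mathbb C)$ satisfy $\operatorname{Tr}(C_m^q)=N\delta_{m,q}$ for $q=1,\dots,N$. Then the $N$ eigenvalues of $C_m$, counted with algebraic multiplicity, can be indexed as $\lambda_{ts}$ with $t=1,\dots,N/m$ and $s=1,\dots,m$ in such a way that for all $t,s$ $$\lambda_{ts}=e^{2\pi i s/m}\;W\!\left(-e^{2\pi i m(t-1/2)/N-1}\right)^{-1/m}\,(1+\varepsilon_{ts}),\qquad |\varepsilon_{ts}|\le K\,N^{-1/2}.$$ Here $W$ is the principal branch of the Lambert $W$ function: $W(z)$ is the solution $w$ of $we^w=z$ in the standard range of the principal branch, which is the part of the strip $|\operatorname{Im}w|<\pi$ on or to the right of the curve $\{-\eta\cot\eta+i\eta:-\pi<\eta<\pi\}$ (with the value $-1$ at $\eta=0$), where the part of the curve with $\eta\ge0$ is included and the part with $\eta<0$ is excluded. The power $-1/m$ is the principal one. -/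

import Mathlib

/-- The range of the principal branch of the Lambert `W` function: the part of the strip
`|Im w| < π` that lies on or to the right of the curve `{-η cot η + i η : -π < η < π}` (completed
by the point `-1` at `η = 0`). The upper half of the curve, with the point `-1`, belongs to the
range and the lower half does not: on the branch cut `(-∞, -1/e]` the principal branch takes its
limit values from above. -/
def lambertWRange : Set ℂ :=
  {w | (w.im = 0 ∧ -1 ≤ w.re) ∨
       (0 < w.im ∧ w.im < Real.pi ∧ -(w.im * Real.cot w.im) ≤ w.re) ∨
       (-Real.pi < w.im ∧ w.im < 0 ∧ -(w.im * Real.cot w.im) < w.re)}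

/-- The principal branch of the Lambert `W` function: `lambertW z` is the solution `w` of
`w * exp w = z` that lies in `lambertWRange`. -/
noncomputable def lambertW (z : ℂ) : ℂ :=
  Classical.epsilon fun w : ℂ => w ∈ lambertWRange ∧ w * Complex.exp w = z

/-- The leading approximation
`exp (2 π i s / m) * W (-exp (2 π i m (t - 1/2) / N - 1)) ^ (-1/m)`, with the principal branches
of `W` and of the power. -/
noncomputable def approxEigenvalue (m N t s : ℕ) : ℂ :=
  Complex.exp (2 * Real.pi * Complex.I * s / m) *
    lambertW (-Complex.exp (2 * Real.pi * Complex.I * m * (t - 1 / 2) / N - 1)) ^ (-(1 : ℂ) / m)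

/-! Put n = N/m. Newton's identities turn the trace conditions into a formula for the characteristic
polynomial, a truncated exponential series in `X ^ m`. Hence each eigenvalue satisfies λ^m = -1/z
with z a zero of T(nz), where T is the exponential series cut after degree n. What remains is
Szegő's description of these zeros, with an exact numbering and uniformly up to the critical point z
= 1.

The zeros solve R(z) = 1 for R(z) = 1 - exp(-nz) T(nz), and R' = c z^n exp(-nz) is a single term.
With z = exp l, write R = c G(l) exp((n+1) l - n exp l). The crucial fact is Re G > 0 for Re l ≤ 0
(`normRemainder_re_pos`). So Φ = log R is defined there through the principal log of G, and Φ' = 1/G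
has positive real part, which makes Φ injective. By Eneström–Kakeya all zeros have |z| ≤ 1, and they
sit at levels Φ = 2πik with 1 ≤ k ≤ n. There are n simple zeros, so every level is taken exactly
once (`exists_revTruncExp_eq_prod`).

The matching point S = log W + πi satisfies S - exp S = iθ - 1 with θ = 2π(t - 1/2)/n. Subtracting
the equations for l and S, n times the difference of l - exp l at the two points is πi minus an
error of logarithmic size, by upper and lower bounds on |G| and Stirling. The map l - exp l is
critical at 0, but Re S ≤ -1/(6√n), which is just enough to conclude |l - S| ≤ 2000/√n
(`sqrt_mul_norm_sub_le`). Taking m-th roots divides this by m. -/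

/-! ### Traces of powers and the characteristic polynomial -/

-- Both sides are multiplicative in `p`, and for a linear factor the determinant is the
-- characteristic polynomial up to sign.
open Polynomial in
theorem Matrix.det_aeval_eq_prod_roots {N : ℕ} (A : Matrix (Fin N) (Fin N) ℂ) (p : ℂ[X]) :
    (aeval A p).det = (A.charpoly.roots.map fun x => p.eval x).prod := by
  have hroots : (A.charpoly.roots.map fun a => X - C a).prod = A.charpoly :=
    prod_multiset_X_sub_C_of_monic_of_roots_card_eq A.charpoly_monic
      (IsAlgClosed.splits A.charpoly).natDegree_eq_card_roots.symm
  have hcard : A.charpoly.roots.card = N := by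
    rw [← (IsAlgClosed.splits A.charpoly).natDegree_eq_card_roots, A.charpoly_natDegree_eq_dim,
      Fintype.card_fin]
  have hlin : ∀ a : ℂ, (aeval A (X - C a)).det
      = (A.charpoly.roots.map fun x => (X - C a : ℂ[X]).eval x).prod := by
    intro a
    have h1 : A.charpoly.eval a = (A.charpoly.roots.map fun x => a - x).prod := by
      conv_lhs => rw [← hroots]
      rw [eval_multiset_prod, Multiset.map_map]
      simp
    have h2 : aeval A (X - C a) = -(Matrix.scalar (Fin N) a - A) := by
      simp [Matrix.algebraMap_eq_diagonal, Matrix.scalar_apply, Pi.algebraMap_def]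
    have h3 : (-1 : ℂ) ^ N = (A.charpoly.roots.map fun _ => (-1 : ℂ)).prod := by
      rw [Multiset.map_const', Multiset.prod_replicate, hcard]
    rw [h2, Matrix.det_neg, ← Matrix.eval_charpoly, h1, Fintype.card_fin, h3,
      ← Multiset.prod_map_mul]
    simp
  have hprod : ∀ s : Multiset ℂ, (aeval A (s.map fun a => X - C a).prod).det
      = (A.charpoly.roots.map fun x => ((s.map fun a => X - C a).prod : ℂ[X]).eval x).prod := by
    intro s
    induction s using Multiset.induction_on with
    | empty => simp
    | cons a s ih =>
      rw [Multiset.map_cons, Multiset.prod_cons, map_mul, Matrix.det_mul, ih, hlin,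
        ← Multiset.prod_map_mul]
      simp only [eval_mul]
  have hp := (IsAlgClosed.splits p).eq_prod_roots
  rw [hp, map_mul, Matrix.det_mul, hprod]
  simp only [eval_mul, Multiset.prod_map_mul, eval_C, aeval_C]
  congr 1
  rw [Multiset.map_const', Multiset.prod_replicate, hcard, Matrix.algebraMap_eq_diagonal]
  simp

open Polynomial in
theorem Matrix.trace_pow_eq_sum_roots_pow {N : ℕ} (A : Matrix (Fin N) (Fin N) ℂ) (q : ℕ) :
    (A ^ q).trace = (A.charpoly.roots.map fun x => x ^ q).sum := by
  have h : (A ^ q).charpoly = ((A.charpoly.roots.map fun x => x ^ q).map fun a => X - C a).prod := by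
    apply Polynomial.funext
    intro x
    have h1 : Matrix.scalar (Fin N) x - A ^ q = aeval A (C x - X ^ q) := by
      simp [Matrix.algebraMap_eq_diagonal, Matrix.scalar_apply, Pi.algebraMap_def]
    rw [Matrix.eval_charpoly, h1, Matrix.det_aeval_eq_prod_roots, eval_multiset_prod,
      Multiset.map_map, Multiset.map_map]
    simp
  rw [Matrix.trace_eq_sum_roots_charpoly, h, roots_multiset_prod_X_sub_C]

/-- Newton's identities for the elementary symmetric functions of a multiset. -/
theorem Multiset.mul_esymm_eq_sum (s : Multiset ℂ) (k : ℕ) :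
    (k : ℂ) * s.esymm k = (-1) ^ (k + 1) *
      ∑ a ∈ Finset.HasAntidiagonal.antidiagonal k with a.1 < k,
        (-1) ^ a.1 * s.esymm a.1 * (s.map fun x => x ^ a.2).sum := by
  obtain ⟨l, rfl⟩ := Quot.exists_rep s
  have hl : (Finset.univ : Finset (Fin l.length)).val.map l.get = (l : Multiset ℂ) := by
    rw [Fin.univ_val_map, List.ofFn_get]
  change (k : ℂ) * (l : Multiset ℂ).esymm k = (-1) ^ (k + 1) *
      ∑ a ∈ Finset.HasAntidiagonal.antidiagonal k with a.1 < k,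
        (-1) ^ a.1 * (l : Multiset ℂ).esymm a.1 * ((l : Multiset ℂ).map fun x => x ^ a.2).sum
  have := congrArg (MvPolynomial.aeval l.get)
    (MvPolynomial.mul_esymm_eq_sum (Fin l.length) ℂ k)
  simp only [map_mul, map_natCast, map_pow, map_neg, map_one, map_sum,
    MvPolynomial.aeval_esymm_eq_multiset_esymm, hl, MvPolynomial.psum, MvPolynomial.aeval_X] at this
  rw [this]
  congr 1
  apply Finset.sum_congr rfl
  intro a _
  rw [← hl, Multiset.map_map]
  rfl

/-- Only the m-th power sum survives in Newton's identity, so a_k = (-1)^k e_k obeys k a_k = -mn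
a_{k-m}. For k = mj this is the recursion of (-n)^j / j!. -/
theorem Multiset.esymm_of_psum_eq_ite (s : Multiset ℂ) {m n : ℕ} (hm : 0 < m)
    (h : ∀ q ∈ Finset.Icc 1 (m * n), (s.map fun x => x ^ q).sum
      = if q = m then ((m * n : ℕ) : ℂ) else 0) (k : ℕ) (hk : k ≤ m * n) :
    (-1) ^ k * s.esymm k = if m ∣ k then (-(n : ℂ)) ^ (k / m) / (k / m).factorial else 0 := by
  induction k using Nat.strong_induction_on with
  | _ k ih =>
  rcases Nat.eq_zero_or_pos k with rfl | hk0
  · simp [Multiset.esymm]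
  have hN := s.mul_esymm_eq_sum k
  have hsum : ∑ a ∈ Finset.HasAntidiagonal.antidiagonal k with a.1 < k,
        (-1) ^ a.1 * s.esymm a.1 * (s.map fun x => x ^ a.2).sum
      = if m ≤ k then (-1) ^ (k - m) * s.esymm (k - m) * ((m * n : ℕ) : ℂ) else 0 := by
    have : ∀ a ∈ (Finset.HasAntidiagonal.antidiagonal k).filter (fun a => a.1 < k),
        (-1) ^ a.1 * s.esymm a.1 * (s.map fun x => x ^ a.2).sum
        = if a = (k - m, m) then (-1) ^ (k - m) * s.esymm (k - m) * ((m * n : ℕ) : ℂ) else 0 := by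
      intro a ha
      rw [Finset.mem_filter, Finset.HasAntidiagonal.mem_antidiagonal] at ha
      rw [h a.2 (by rw [Finset.mem_Icc]; omega)]
      by_cases h2 : a.2 = m
      · have h1 : a.1 = k - m := by omega
        have h3 : a = (k - m, m) := Prod.ext h1 h2
        simp [h3]
      · have h3 : a ≠ (k - m, m) := fun h => h2 (by rw [h])
        simp [h2, h3]
    rw [Finset.sum_congr rfl this, Finset.sum_ite_eq']
    simp only [Finset.mem_filter, Finset.HasAntidiagonal.mem_antidiagonal]
    congr 1
    apply propext
    omega
  rw [hsum] at hN
  have hk1 : (k : ℂ) ≠ 0 := by exact_mod_cast hk0.ne'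
  have hsgn : ((-1 : ℂ) ^ k) * (-1) ^ (k + 1) = -1 := by
    rw [← pow_add, show k + (k + 1) = 2 * k + 1 by ring, pow_succ, pow_mul]; simp
  have hN2 : (k : ℂ) * ((-1) ^ k * s.esymm k)
      = -(if m ≤ k then (-1) ^ (k - m) * s.esymm (k - m) * ((m * n : ℕ) : ℂ) else 0) := by
    calc (k : ℂ) * ((-1) ^ k * s.esymm k) = (-1) ^ k * ((k : ℂ) * s.esymm k) := by ring
      _ = _ := by rw [hN, ← mul_assoc, hsgn, neg_one_mul]
  by_cases hmk : m ≤ k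
  · rw [if_pos hmk, ih (k - m) (by omega) (by omega)] at hN2
    by_cases hd : m ∣ k
    · obtain ⟨j, rfl⟩ := hd
      have hj : j ≠ 0 := by rintro rfl; simp at hk0
      obtain ⟨i, rfl⟩ := Nat.exists_eq_succ_of_ne_zero hj
      have e1 : m * (i + 1) - m = m * i := by rw [Nat.mul_succ]; omega
      rw [Nat.succ_eq_add_one] at *
      rw [e1, if_pos (dvd_mul_right _ _), Nat.mul_div_cancel_left _ hm] at hN2
      rw [if_pos (dvd_mul_right _ _), Nat.mul_div_cancel_left _ hm]
      apply mul_left_cancel₀ hk1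
      rw [hN2, Nat.factorial_succ]
      have hi : (i.factorial : ℂ) ≠ 0 := by exact_mod_cast i.factorial_ne_zero
      have hi1 : ((i : ℂ) + 1) ≠ 0 := by exact_mod_cast Nat.succ_ne_zero i
      push_cast
      field_simp
      ring
    · have hd' : ¬ m ∣ k - m := fun h' => hd (by simpa [Nat.sub_add_cancel hmk] using dvd_add h' (dvd_refl m))
      rw [if_neg hd', zero_mul, neg_zero] at hN2
      rw [if_neg hd]
      exact (mul_eq_zero.1 hN2).resolve_left hk1
  · rw [if_neg hmk, neg_zero] at hN2
    have hd : ¬ m ∣ k := fun h => hmk (Nat.le_of_dvd hk0 h)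
    rw [if_neg hd]
    exact (mul_eq_zero.1 hN2).resolve_left hk1

open Polynomial in
/-- A matrix whose traces of powers are `N δ_{q,m}` has as characteristic polynomial a truncated
exponential series in `X ^ m`. -/
theorem Matrix.charpoly_of_trace_pow_eq_ite {m n : ℕ} (hm : 0 < m)
    (A : Matrix (Fin (m * n)) (Fin (m * n)) ℂ)
    (h : ∀ q ∈ Finset.Icc 1 (m * n), (A ^ q).trace = if q = m then ((m * n : ℕ) : ℂ) else 0) :
    A.charpoly = (∑ j ∈ Finset.range (n + 1),
      C ((-(n : ℂ)) ^ j / j.factorial) * X ^ (n - j)).comp (X ^ m) := by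
  have hroots : (A.charpoly.roots.map fun a => X - C a).prod = A.charpoly :=
    prod_multiset_X_sub_C_of_monic_of_roots_card_eq A.charpoly_monic
      (IsAlgClosed.splits A.charpoly).natDegree_eq_card_roots.symm
  have hcard : A.charpoly.roots.card = m * n := by
    rw [← (IsAlgClosed.splits A.charpoly).natDegree_eq_card_roots, A.charpoly_natDegree_eq_dim,
      Fintype.card_fin]
  have hsym := A.charpoly.roots.esymm_of_psum_eq_ite hm (n := n)
    (fun q hq => by rw [← Matrix.trace_pow_eq_sum_roots_pow, h q hq])
  have hlhs : A.charpoly = ∑ k ∈ Finset.range (m * n + 1),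
      C ((-1) ^ k * A.charpoly.roots.esymm k) * X ^ (m * n - k) := by
    conv_lhs => rw [← hroots, Multiset.prod_X_sub_X_eq_sum_esymm, hcard]
    simp [mul_assoc]
  rw [hlhs]
  have hrhs : (∑ j ∈ Finset.range (n + 1),
      C ((-(n : ℂ)) ^ j / j.factorial) * X ^ (n - j)).comp (X ^ m)
      = ∑ j ∈ Finset.range (n + 1),
        C ((-(n : ℂ)) ^ j / j.factorial) * X ^ (m * n - m * j) := by
    rw [sum_comp]
    apply Finset.sum_congr rfl
    intro j _
    rw [mul_comp, C_comp, pow_comp, X_comp, ← pow_mul, Nat.mul_sub]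
  rw [hrhs]
  rw [Finset.sum_congr rfl (g := fun k => if m ∣ k then
    C ((-(n : ℂ)) ^ (k / m) / (k / m).factorial) * X ^ (m * n - k) else 0)
    (fun k hk => by
      rw [hsym k (by rw [Finset.mem_range] at hk; omega)]
      split_ifs <;> simp)]
  rw [← Finset.sum_filter]
  symm
  apply Finset.sum_bij (fun j _ => m * j)
  · intro j hj
    rw [Finset.mem_range] at hj
    rw [Finset.mem_filter, Finset.mem_range]
    exact ⟨Nat.lt_succ_of_le (Nat.mul_le_mul_left m (by omega)), dvd_mul_right _ _⟩
  · intro a _ b _ hab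
    exact Nat.eq_of_mul_eq_mul_left hm hab
  · intro b hb
    rw [Finset.mem_filter, Finset.mem_range] at hb
    obtain ⟨hb, j, rfl⟩ := hb
    refine ⟨j, ?_, rfl⟩
    rw [Finset.mem_range]
    exact Nat.lt_succ_of_le (Nat.le_of_mul_le_mul_left (by omega) hm)
  · intro j _
    rw [Nat.mul_div_cancel_left _ hm]

open Polynomial in
theorem Polynomial.X_pow_sub_C_pow_eq_prod_Icc {m : ℕ} (hm : 0 < m) (x : ℂ) :
    (X ^ m - C (x ^ m) : ℂ[X])
      = ∏ s ∈ Finset.Icc 1 m, (X - C (Complex.exp (2 * Real.pi * Complex.I * s / m) * x)) := by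
  have hprim := Complex.isPrimitiveRoot_exp m hm.ne'
  rw [X_pow_sub_C_eq_prod hprim hm rfl]
  have hpow : ∀ i : ℕ, Complex.exp (2 * Real.pi * Complex.I / m) ^ i
      = Complex.exp (2 * Real.pi * Complex.I * i / m) := by
    intro i
    rw [← Complex.exp_nat_mul]
    congr 1
    ring
  obtain ⟨k, rfl⟩ := Nat.exists_eq_succ_of_ne_zero hm.ne'
  rw [Nat.succ_eq_add_one] at *
  have hIcc : ∏ s ∈ Finset.Icc 1 (k + 1),
      (X - C (Complex.exp (2 * Real.pi * Complex.I / (k + 1 : ℕ)) ^ s * x) : ℂ[X])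
      = ∏ i ∈ Finset.range (k + 1),
        (X - C (Complex.exp (2 * Real.pi * Complex.I / (k + 1 : ℕ)) ^ (i + 1) * x)) := by
    rw [Finset.range_eq_Ico, Finset.prod_Ico_add'
      (fun i => (X - C (Complex.exp (2 * Real.pi * Complex.I / (k + 1 : ℕ)) ^ i * x) : ℂ[X]))]
    rfl
  simp only [← hpow]
  -- The two index ranges differ only in s = m against s = 0, which give the same root of unity.
  rw [hIcc, Finset.prod_range_succ', Finset.prod_range_succ, hprim.pow_eq_one, pow_zero]

/-! ### The relative remainder of the exponential series -/

/-- The exponential series truncated after the term of degree `n`. -/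
noncomputable def truncExp (n : ℕ) (w : ℂ) : ℂ :=
  ∑ k ∈ Finset.range (n + 1), w ^ k / k.factorial

theorem hasDerivAt_truncExp (n : ℕ) (w : ℂ) :
    HasDerivAt (truncExp n) (truncExp n w - w ^ n / n.factorial) w := by
  unfold truncExp
  induction n with
  | zero =>
    simpa using hasDerivAt_const w (1 : ℂ)
  | succ n ih =>
    have h1 : HasDerivAt (fun w : ℂ => w ^ (n + 1) / ((n + 1).factorial : ℂ))
        (w ^ n / n.factorial) w := by
      have h := (hasDerivAt_pow (n + 1) w).div_const ((n + 1).factorial : ℂ)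
      refine h.congr_deriv ?_
      have hi : (n.factorial : ℂ) ≠ 0 := by exact_mod_cast n.factorial_ne_zero
      have hi1 : ((n : ℂ) + 1) ≠ 0 := by exact_mod_cast Nat.succ_ne_zero n
      rw [Nat.factorial_succ]
      push_cast
      field_simp
    simp_rw [Finset.sum_range_succ _ (n + 1)]
    have h := ih.add h1
    rw [sub_add_cancel] at h
    rw [add_sub_cancel_right]
    exact h

/-- The relative remainder `1 - exp (-n z) * truncExp n (n z)`. -/
noncomputable def expRemainder (n : ℕ) (z : ℂ) : ℂ :=
  1 - Complex.exp (-(n * z)) * truncExp n (n * z)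

/-- The constant in the derivative of `expRemainder`. -/
noncomputable def remainderCoeff (n : ℕ) : ℝ := (n : ℝ) ^ (n + 1) / n.factorial

theorem remainderCoeff_pos {n : ℕ} (hn : 0 < n) : 0 < remainderCoeff n := by
  unfold remainderCoeff
  positivity

/-- The truncated series is its own derivative up to the top term, so everything else cancels. -/
theorem hasDerivAt_expRemainder (n : ℕ) (z : ℂ) :
    HasDerivAt (expRemainder n) (remainderCoeff n * (z ^ n * Complex.exp (-(n * z)))) z := by
  have h1 : HasDerivAt (fun z : ℂ => (n : ℂ) * z) n z := by
    simpa using (hasDerivAt_id z).const_mul (n : ℂ)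
  have h2 := (hasDerivAt_truncExp n (n * z)).comp z h1
  have h3 := h1.neg.cexp
  have h4 := (h3.mul h2).const_sub 1
  refine h4.congr_deriv ?_
  simp only [remainderCoeff, Function.comp, Pi.neg_apply]
  push_cast
  ring

theorem expRemainder_zero (n : ℕ) : expRemainder n 0 = 0 := by
  simp [expRemainder, truncExp, Finset.sum_range_succ']

theorem truncExp_conj (n : ℕ) (w : ℂ) :
    truncExp n (starRingEnd ℂ w) = starRingEnd ℂ (truncExp n w) := by
  simp [truncExp]

theorem expRemainder_conj (n : ℕ) (z : ℂ) :
    expRemainder n (starRingEnd ℂ z) = starRingEnd ℂ (expRemainder n z) := by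
  unfold expRemainder
  have h : (n : ℂ) * starRingEnd ℂ z = starRingEnd ℂ (n * z) := by simp
  rw [h, truncExp_conj, ← map_neg, Complex.exp_conj, ← map_mul, map_sub, map_one]

/-- The function `exp (n z) * expRemainder n z / (remainderCoeff n * z ^ (n + 1))` in the
logarithmic coordinate `z = exp l`. -/
noncomputable def normRemainder (n : ℕ) (l : ℂ) : ℂ :=
  expRemainder n (Complex.exp l) * Complex.exp (n * Complex.exp l - (n + 1) * l) / remainderCoeff n

theorem hasDerivAt_normRemainder {n : ℕ} (hn : 0 < n) (l : ℂ) :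
    HasDerivAt (normRemainder n)
      (1 - (n + 1 - n * Complex.exp l) * normRemainder n l) l := by
  have hc : (remainderCoeff n : ℂ) ≠ 0 := by exact_mod_cast (remainderCoeff_pos hn).ne'
  have h1 := (hasDerivAt_expRemainder n (Complex.exp l)).comp l (Complex.hasDerivAt_exp l)
  have h2 : HasDerivAt (fun l : ℂ => (n : ℂ) * Complex.exp l - (n + 1) * l)
      (n * Complex.exp l - (n + 1)) l := by
    refine (((Complex.hasDerivAt_exp l).const_mul (n : ℂ)).sub
      ((hasDerivAt_id l).const_mul ((n : ℂ) + 1))).congr_deriv ?_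
    simp
  have h3 := (h1.mul h2.cexp).div_const (remainderCoeff n : ℂ)
  refine h3.congr_deriv ?_
  have e : Complex.exp l ^ n * Complex.exp (-(n * Complex.exp l)) * Complex.exp l
      * Complex.exp (n * Complex.exp l - (n + 1) * l) = 1 := by
    rw [← Complex.exp_nat_mul, ← Complex.exp_add, ← Complex.exp_add, ← Complex.exp_add]
    convert! Complex.exp_zero using 2
    ring
  simp only [normRemainder, Function.comp]
  field_simp
  linear_combination (remainderCoeff n : ℂ) * e

theorem expRemainder_exp {n : ℕ} (hn : 0 < n) (l : ℂ) :
    expRemainder n (Complex.exp l)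
      = remainderCoeff n * normRemainder n l * Complex.exp ((n + 1) * l - n * Complex.exp l) := by
  have hc : (remainderCoeff n : ℂ) ≠ 0 := by exact_mod_cast (remainderCoeff_pos hn).ne'
  unfold normRemainder
  rw [mul_div_cancel₀ _ hc, mul_assoc, ← Complex.exp_add]
  simp

/-- The exponent contains l only with the integer factor n + 1, so the function has period 2πi. -/
theorem normRemainder_eq_of_exp_eq {n : ℕ} {l l' : ℂ} (h : Complex.exp l = Complex.exp l') :
    normRemainder n l = normRemainder n l' := by
  unfold normRemainder
  have : ∀ l : ℂ, Complex.exp (n * Complex.exp l - (n + 1) * l)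
      = Complex.exp (n * Complex.exp l) / Complex.exp l ^ (n + 1) := by
    intro l
    rw [Complex.exp_sub, ← Complex.exp_nat_mul]
    push_cast
    rfl
  rw [this, this, h]

theorem normRemainder_conj (n : ℕ) (l : ℂ) :
    normRemainder n (starRingEnd ℂ l) = starRingEnd ℂ (normRemainder n l) := by
  unfold normRemainder
  have h : (n : ℂ) * Complex.exp (starRingEnd ℂ l) - (n + 1) * starRingEnd ℂ l
      = starRingEnd ℂ (n * Complex.exp l - (n + 1) * l) := by
    simp [Complex.exp_conj]
  rw [h, Complex.exp_conj, Complex.exp_conj, expRemainder_conj, ← map_mul, map_div₀,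
    Complex.conj_ofReal]

/-! ### Positivity of the real part of the normalized remainder -/

/-- The quantity is the real part of the tangent of `steepestCurve` at `y`, rotated by -y₀. The
hypothesis `hc'` says that the end point of the curve at y₀ lies in the closed unit disc. -/
theorem steepest_direction_pos {y₀ y c : ℝ} (hy₀ : y₀ < Real.pi) (hc : 0 < c)
    (hc' : y₀ - Real.sin y₀ ≤ c) (h1 : c < y) (h2 : y < y₀) :
    0 < (Real.cos y / Real.sin y - (y - c) / Real.sin y ^ 2) * Real.cos y₀ + Real.sin y₀ := by
  have hpi := Real.pi_gt_three
  have hs : 0 < Real.sin y := Real.sin_pos_of_pos_of_lt_pi (by linarith) (by linarith)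
  have key : 0 < Real.sin y * Real.cos (y₀ - y) - (y - c) * Real.cos y₀ := by
    rcases le_or_gt 0 (Real.cos y₀) with h | h
    · have hy : y₀ ≤ Real.pi / 2 := by
        by_contra! hlt
        exact absurd (Real.cos_neg_of_pi_div_two_lt_of_lt hlt (by linarith)) (not_lt.2 h)
      have hcy : 0 < Real.cos y := Real.cos_pos_of_mem_Ioo ⟨by linarith, by linarith⟩
      have hcd : 0 < Real.cos (y₀ - y) := Real.cos_pos_of_mem_Ioo ⟨by linarith, by linarith⟩
      have htan : y * Real.cos y < Real.sin y := by
        have := Real.lt_tan (show 0 < y by linarith) (by linarith)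
        rwa [Real.tan_eq_sin_div_cos, lt_div_iff₀ hcy] at this
      have h3 : Real.cos y₀ ≤ Real.cos y * Real.cos (y₀ - y) := by
        have e : y₀ = y + (y₀ - y) := by ring
        have h4 : Real.cos y₀ = Real.cos y * Real.cos (y₀ - y) - Real.sin y * Real.sin (y₀ - y) := by
          conv_lhs => rw [e, Real.cos_add]
        have h5 : 0 ≤ Real.sin (y₀ - y) :=
          Real.sin_nonneg_of_nonneg_of_le_pi (by linarith) (by linarith)
        nlinarith
      nlinarith [mul_pos hc hcy]
    · have hcd : 0 < Real.cos (y₀ - y) :=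
        -- Here y₀ - y < y₀ - c ≤ sin y₀ ≤ 1 < π/2.
        Real.cos_pos_of_mem_Ioo ⟨by linarith, by linarith [Real.sin_le_one y₀]⟩
      nlinarith [mul_pos hs hcd]
  have e : (Real.cos y / Real.sin y - (y - c) / Real.sin y ^ 2) * Real.cos y₀ + Real.sin y₀
      = (Real.sin y * Real.cos (y₀ - y) - (y - c) * Real.cos y₀) / Real.sin y ^ 2 := by
    rw [Real.cos_sub]
    field_simp
    ring
  rw [e]
  positivity

/-- The curve of constant argument of `z * exp (-z)`. -/
noncomputable def steepestCurve (c y : ℝ) : ℂ :=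
  ((y - c) * (Real.cos y / Real.sin y) : ℝ) + ((y - c : ℝ) : ℂ) * Complex.I

theorem hasDerivAt_steepestCurve (c : ℝ) {y : ℝ} (hy : Real.sin y ≠ 0) :
    HasDerivAt (steepestCurve c)
      (((Real.cos y / Real.sin y - (y - c) / Real.sin y ^ 2 : ℝ) : ℂ) + Complex.I) y := by
  have h0 : HasDerivAt (fun y : ℝ => y - c) 1 y := (hasDerivAt_id y).sub_const c
  have h1 : HasDerivAt (fun y : ℝ => (y - c) * (Real.cos y / Real.sin y))
      (Real.cos y / Real.sin y - (y - c) / Real.sin y ^ 2) y := by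
    have h := h0.mul ((Real.hasDerivAt_cos y).div (Real.hasDerivAt_sin y) hy)
    refine h.congr_deriv ?_
    have hs := Real.sin_sq_add_cos_sq y
    rw [Pi.div_apply]
    field_simp
    linear_combination (-(y - c)) * hs
  have h2 := h1.ofReal_comp.add (h0.ofReal_comp.mul_const Complex.I)
  refine h2.congr_deriv ?_
  simp

theorem steepestCurve_eq {c y : ℝ} (hy : Real.sin y ≠ 0) :
    steepestCurve c y = (((y - c) / Real.sin y : ℝ) : ℂ) * Complex.exp (y * Complex.I) := by
  unfold steepestCurve
  have : (Complex.sin y) ≠ 0 := by rw [← Complex.ofReal_sin]; exact_mod_cast hy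
  rw [Complex.exp_mul_I]
  push_cast
  field_simp

theorem steepestCurve_mul_exp_neg {c y : ℝ} (hy : Real.sin y ≠ 0) :
    steepestCurve c y * Complex.exp (-steepestCurve c y)
      = (((y - c) / Real.sin y * Real.exp (-((y - c) * (Real.cos y / Real.sin y))) : ℝ) : ℂ)
        * Complex.exp (c * Complex.I) := by
  conv_lhs => enter [1]; rw [steepestCurve_eq hy]
  unfold steepestCurve
  rw [Complex.ofReal_mul _ (Real.exp _), Complex.ofReal_exp, mul_assoc, mul_assoc,
    ← Complex.exp_add, ← Complex.exp_add]
  congr 2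
  push_cast
  ring

/-- Integrate R' along the curve from 0, its point at y = c. The factor z^n exp(-nz) has constant
argument nc there, so the sign is decided by the tangent direction alone. -/
theorem expRemainder_steepestCurve_pos {n : ℕ} (hn : 0 < n) {y₀ c : ℝ} (hy₀ : y₀ < Real.pi)
    (hc : 0 < c) (hcy : c < y₀) (hc' : y₀ - Real.sin y₀ ≤ c) :
    0 < (expRemainder n (steepestCurve c y₀)
      * Complex.exp (-((n * c + y₀ : ℝ) * Complex.I))).re := by
  set F : ℝ → ℝ := fun y => (expRemainder n (steepestCurve c y)
      * Complex.exp (-((n * c + y₀ : ℝ) * Complex.I))).re with hF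
  have hsin : ∀ y ∈ Set.Icc c y₀, 0 < Real.sin y := fun y hy =>
    Real.sin_pos_of_pos_of_lt_pi (by linarith [hy.1]) (by linarith [hy.2])
  have hder : ∀ y ∈ Set.Icc c y₀, HasDerivAt F
      (remainderCoeff n
        * ((y - c) / Real.sin y * Real.exp (-((y - c) * (Real.cos y / Real.sin y)))) ^ n
        * ((Real.cos y / Real.sin y - (y - c) / Real.sin y ^ 2) * Real.cos y₀
          + Real.sin y₀)) y := by
    intro y hy
    have hs := (hsin y hy).ne'
    have h1 := ((hasDerivAt_expRemainder n (steepestCurve c y)).comp y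
      (hasDerivAt_steepestCurve c hs)).mul_const
        (Complex.exp (-((n * c + y₀ : ℝ) * Complex.I)))
    have h2 := Complex.reCLM.hasFDerivAt.comp_hasDerivAt y h1
    refine h2.congr_deriv ?_
    set a := Real.cos y / Real.sin y - (y - c) / Real.sin y ^ 2
    set ρ := (y - c) / Real.sin y * Real.exp (-((y - c) * (Real.cos y / Real.sin y))) with hρ
    have e1 : steepestCurve c y ^ n * Complex.exp (-(n * steepestCurve c y))
        = ((ρ ^ n : ℝ) : ℂ) * Complex.exp (n * (c * Complex.I)) := by
      rw [← mul_neg, Complex.exp_nat_mul, ← mul_pow, steepestCurve_mul_exp_neg hs, mul_pow,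
        Complex.exp_nat_mul, Complex.ofReal_pow]
    have e2 : Complex.exp (n * (c * Complex.I)) * Complex.exp (-((n * c + y₀ : ℝ) * Complex.I))
        = Complex.exp ((-y₀ : ℝ) * Complex.I) := by
      rw [← Complex.exp_add]
      congr 1
      push_cast
      ring
    have e3 : (remainderCoeff n : ℂ) * (steepestCurve c y ^ n
          * Complex.exp (-(n * steepestCurve c y))) * ((a : ℂ) + Complex.I)
          * Complex.exp (-((n * c + y₀ : ℝ) * Complex.I))
        = ((remainderCoeff n * ρ ^ n : ℝ) : ℂ) * (((a : ℂ) + Complex.I)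
          * Complex.exp ((-y₀ : ℝ) * Complex.I)) := by
      rw [e1, ← e2]
      push_cast
      ring
    rw [e3]
    rw [Complex.reCLM_apply, Complex.re_ofReal_mul, Complex.mul_re, Complex.exp_ofReal_mul_I_re,
      Complex.exp_ofReal_mul_I_im]
    simp
  have hmono : StrictMonoOn F (Set.Icc c y₀) := by
    apply strictMonoOn_of_deriv_pos (convex_Icc c y₀)
      (fun y hy => (hder y hy).continuousAt.continuousWithinAt)
    intro y hy
    rw [interior_Icc] at hy
    have hy' := Set.Ioo_subset_Icc_self hy
    rw [(hder y hy').deriv]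
    have h1 := steepest_direction_pos hy₀ hc hc' hy.1 hy.2
    have h2 := hsin y hy'
    have h3 := remainderCoeff_pos hn
    have h4 : 0 < y - c := by linarith [hy.1]
    positivity
  have h0 : F c = 0 := by
    simp [hF, steepestCurve, expRemainder_zero]
  rw [← h0]
  exact hmono (Set.left_mem_Icc.2 hcy.le) (Set.right_mem_Icc.2 hcy.le) hcy

theorem normRemainder_re_pos_of_im_pos {n : ℕ} (hn : 0 < n) {l : ℂ} (hl : l.re ≤ 0)
    (h0 : 0 < l.im) (hpi : l.im < Real.pi) : 0 < (normRemainder n l).re := by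
  have hs : 0 < Real.sin l.im := Real.sin_pos_of_pos_of_lt_pi h0 hpi
  have hx : Real.exp l.re ≤ 1 := Real.exp_le_one_iff.2 hl
  have hx0 := Real.exp_pos l.re
  -- This is Im(l - exp l), the argument of z exp(-z) at z = exp l; the curve with this `c` reaches
  -- exp l at height Im l.
  set c := l.im - Real.exp l.re * Real.sin l.im with hc
  have hsl : Real.sin l.im < l.im := Real.sin_lt h0
  have hexp : steepestCurve c l.im = Complex.exp l := by
    rw [steepestCurve_eq hs.ne', hc, sub_sub_cancel, mul_div_cancel_right₀ _ hs.ne',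
      Complex.ofReal_exp, ← Complex.exp_add, Complex.re_add_im]
  have h := expRemainder_steepestCurve_pos hn (c := c) hpi (by nlinarith) (by nlinarith)
    (by nlinarith)
  rw [hexp, expRemainder_exp hn, mul_assoc, ← Complex.exp_add] at h
  have e : ((n : ℂ) + 1) * l - n * Complex.exp l + -((n * c + l.im : ℝ) * Complex.I)
      = (((n + 1) * l.re - n * (Complex.exp l).re : ℝ) : ℂ) := by
    apply Complex.ext
    · simp
    · simp [Complex.exp_im]
      rw [hc]
      ring
  rw [e, ← Complex.ofReal_exp, mul_comm _ (Complex.ofReal _), ← mul_assoc, ← Complex.ofReal_mul,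
    Complex.re_ofReal_mul] at h
  exact (pos_iff_pos_of_mul_pos h).1 (mul_pos (Real.exp_pos _) (remainderCoeff_pos hn))

/-- On the real axis the steepest curve degenerates to a ray, with ε = ±1 its direction; the
integrand has constant sign along it. -/
theorem expRemainder_real_pos {n : ℕ} (hn : 0 < n) {ε t : ℝ} (hε : ε ^ 2 = 1) (ht : 0 < t) :
    0 < (expRemainder n ((ε * t : ℝ) : ℂ) * ((ε ^ (n + 1) : ℝ) : ℂ)).re := by
  set F : ℝ → ℝ := fun t => (expRemainder n ((ε * t : ℝ) : ℂ) * ((ε ^ (n + 1) : ℝ) : ℂ)).re with hF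
  have hder : ∀ y, HasDerivAt F (remainderCoeff n * (y ^ n * Real.exp (-(n * (ε * y))))) y := by
    intro y
    have h0 : HasDerivAt (fun t : ℝ => ((ε * t : ℝ) : ℂ)) ((ε : ℝ) : ℂ) y := by
      have := ((hasDerivAt_id y).const_mul ε).ofReal_comp
      simpa using this
    have h1 := ((hasDerivAt_expRemainder n ((ε * y : ℝ) : ℂ)).comp y h0).mul_const
      ((ε ^ (n + 1) : ℝ) : ℂ)
    have h2 := Complex.reCLM.hasFDerivAt.comp_hasDerivAt y h1
    refine h2.congr_deriv ?_
    have e : (remainderCoeff n : ℂ) * (((ε * y : ℝ) : ℂ) ^ n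
          * Complex.exp (-(n * ((ε * y : ℝ) : ℂ)))) * (ε : ℂ) * ((ε ^ (n + 1) : ℝ) : ℂ)
        = ((remainderCoeff n * (y ^ n * Real.exp (-(n * (ε * y)))) : ℝ) : ℂ) := by
      have h3 : ε ^ n * ε * ε ^ (n + 1) = 1 := by
        rw [← pow_succ, ← mul_pow, ← pow_two, hε, one_pow]
      have h3' : (ε : ℂ) ^ n * ε * ε ^ (n + 1) = 1 := by exact_mod_cast h3
      push_cast
      linear_combination (remainderCoeff n : ℂ) * y ^ n * Complex.exp (-(n * (ε * y))) * h3'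
    rw [e, Complex.reCLM_apply, Complex.ofReal_re]
  have hmono : StrictMonoOn F (Set.Icc 0 t) := by
    apply strictMonoOn_of_deriv_pos (convex_Icc 0 t)
      (fun y _ => (hder y).continuousAt.continuousWithinAt)
    intro y hy
    rw [interior_Icc] at hy
    rw [(hder y).deriv]
    have h3 := remainderCoeff_pos hn
    have h4 : 0 < y := hy.1
    positivity
  have h0 : F 0 = 0 := by simp [hF, expRemainder_zero]
  rw [← h0]
  exact hmono (Set.left_mem_Icc.2 ht.le) (Set.right_mem_Icc.2 ht.le) ht

theorem normRemainder_re_pos_of_exp_real {n : ℕ} (hn : 0 < n) {l : ℂ} {ε : ℝ}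
    (hε : ε ^ 2 = 1) (hl : Complex.exp l = ((ε * Real.exp l.re : ℝ) : ℂ)) :
    0 < (normRemainder n l).re := by
  have h := expRemainder_real_pos hn hε (Real.exp_pos l.re)
  rw [← hl, expRemainder_exp hn, Complex.exp_sub] at h
  have e : Complex.exp (((n : ℂ) + 1) * l) = (((ε * Real.exp l.re) ^ (n + 1) : ℝ) : ℂ) := by
    rw [Complex.ofReal_pow, ← hl, ← Complex.exp_nat_mul]
    push_cast
    rfl
  have hε' : ε ^ (n + 1) * ε ^ (n + 1) = 1 := by rw [← mul_pow, ← pow_two, hε, one_pow]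
  have hε'' : (ε : ℂ) ^ (n + 1) * ε ^ (n + 1) = 1 := by exact_mod_cast hε'
  have e2 : (remainderCoeff n : ℂ) * normRemainder n l * (Complex.exp (((n : ℂ) + 1) * l)
        / Complex.exp (n * Complex.exp l)) * ((ε ^ (n + 1) : ℝ) : ℂ)
      = ((remainderCoeff n * (Real.exp l.re ^ (n + 1)
        / Real.exp (n * (ε * Real.exp l.re))) : ℝ) : ℂ) * normRemainder n l := by
    rw [e, hl]
    push_cast
    rw [mul_pow]
    have hne := Complex.exp_ne_zero (n * (ε * Complex.exp l.re))
    field_simp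
    linear_combination (remainderCoeff n : ℂ) * normRemainder n l * hε''
  rw [e2, Complex.re_ofReal_mul] at h
  have := remainderCoeff_pos hn
  exact (pos_iff_pos_of_mul_pos h).1 (by positivity)

/-- `normRemainder` has positive real part on the closed left half plane. -/
theorem normRemainder_re_pos {n : ℕ} (hn : 0 < n) {l : ℂ} (hl : l.re ≤ 0) :
    0 < (normRemainder n l).re := by
  set l' := Complex.log (Complex.exp l) with hl'
  have hexp : Complex.exp l' = Complex.exp l := Complex.exp_log (Complex.exp_ne_zero l)
  have hre : l'.re = l.re := by
    rw [hl', Complex.log_re, Complex.norm_exp, Real.log_exp]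
  rw [← normRemainder_eq_of_exp_eq hexp]
  have h1 : -Real.pi < l'.im := Complex.neg_pi_lt_log_im _
  have h2 : l'.im ≤ Real.pi := Complex.log_im_le_pi _
  have hpolar : Complex.exp l' = Real.exp l'.re * (Real.cos l'.im + Real.sin l'.im * Complex.I) := by
    rw [Complex.exp_eq_exp_re_mul_sin_add_cos]
    push_cast
    rfl
  rcases lt_trichotomy l'.im 0 with h | h | h
  · have := normRemainder_re_pos_of_im_pos hn (l := starRingEnd ℂ l') (by simpa [hre] using hl)
      (by simpa using h) (by rw [Complex.conj_im]; linarith)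
    rwa [normRemainder_conj, Complex.conj_re] at this
  · refine normRemainder_re_pos_of_exp_real hn (ε := 1) (by norm_num) ?_
    rw [hpolar, h]
    simp
  · rcases h2.lt_or_eq with h2 | h2
    · exact normRemainder_re_pos_of_im_pos hn (by rw [hre]; exact hl) h h2
    · refine normRemainder_re_pos_of_exp_real hn (ε := -1) (by norm_num) ?_
      rw [hpolar, h2]
      simp

/-! ### Upper and lower bounds for the normalized remainder -/

theorem expRemainder_one_re_le (n : ℕ) : (expRemainder n 1).re ≤ 1 := by
  have h : Complex.exp (-((n : ℂ) * 1)) * truncExp n (n * 1)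
      = ((Real.exp (-n) * ∑ k ∈ Finset.range (n + 1), (n : ℝ) ^ k / k.factorial : ℝ) : ℂ) := by
    simp [truncExp]
  rw [expRemainder, h, Complex.sub_re, Complex.ofReal_re, Complex.one_re]
  have : 0 ≤ Real.exp (-n) * ∑ k ∈ Finset.range (n + 1), (n : ℝ) ^ k / k.factorial := by positivity
  linarith

/-- Along the ray from 0 to z, exp(n(1 - t) Re z) ≤ exp(n(1 - t)), so the integrand is dominated by
the one at z = 1, whose total is at most 1 by `expRemainder_one_re_le`. -/
theorem norm_exp_mul_expRemainder_le {n : ℕ} (hn : 0 < n) {z : ℂ} (hz : ‖z‖ ≤ 1) :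
    ‖Complex.exp (n * z) * expRemainder n z‖ ≤ ‖z‖ ^ (n + 1) * Real.exp n := by
  have hc := remainderCoeff_pos hn
  set F : ℝ → ℂ := fun t => Complex.exp (n * z) * expRemainder n (t * z) with hF
  set B : ℝ → ℝ := fun t => ‖z‖ ^ (n + 1) * Real.exp n * (expRemainder n t).re with hB
  have hF' : ∀ t : ℝ, HasDerivAt F (Complex.exp (n * z) * (remainderCoeff n
      * ((t * z) ^ n * Complex.exp (-(n * (t * z)))) * z)) t := by
    intro t
    have h0 : HasDerivAt (fun t : ℝ => (t : ℂ) * z) z t := by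
      simpa using (Complex.ofRealCLM.hasDerivAt (x := t)).mul_const z
    exact ((hasDerivAt_expRemainder n (t * z)).comp t h0).const_mul _
  have hB' : ∀ t : ℝ, HasDerivAt B (‖z‖ ^ (n + 1) * Real.exp n
      * (remainderCoeff n * (t ^ n * Real.exp (-(n * t))))) t := by
    intro t
    have h0 : HasDerivAt (fun t : ℝ => (t : ℂ)) 1 t := Complex.ofRealCLM.hasDerivAt
    have h1 := (Complex.reCLM.hasFDerivAt.comp_hasDerivAt t
      ((hasDerivAt_expRemainder n t).comp t h0)).const_mul (‖z‖ ^ (n + 1) * Real.exp n)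
    refine h1.congr_deriv ?_
    congr 1
    have e : (remainderCoeff n : ℂ) * ((t : ℂ) ^ n * Complex.exp (-(n * t))) * 1
        = ((remainderCoeff n * (t ^ n * Real.exp (-(n * t))) : ℝ) : ℂ) := by
      push_cast
      ring
    rw [e, Complex.reCLM_apply, Complex.ofReal_re]
  have hbound : ∀ t ∈ Set.Ico (0 : ℝ) 1, ‖Complex.exp (n * z) * (remainderCoeff n
      * ((t * z) ^ n * Complex.exp (-(n * (t * z)))) * z)‖ ≤ ‖z‖ ^ (n + 1) * Real.exp n
      * (remainderCoeff n * (t ^ n * Real.exp (-(n * t)))) := by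
    intro t ht
    have hre : z.re ≤ 1 := (Complex.re_le_norm z).trans hz
    rw [norm_mul, norm_mul, norm_mul, norm_mul, norm_pow, norm_mul, Complex.norm_exp,
      Complex.norm_exp, Complex.norm_real, Complex.norm_real, Real.norm_of_nonneg hc.le,
      Real.norm_of_nonneg ht.1]
    have e1 : ((n : ℂ) * z).re = n * z.re := by simp
    have e2 : (-((n : ℂ) * (t * z))).re = -(n * (t * z.re)) := by simp
    rw [e1, e2]
    have h1 : Real.exp (n * z.re) * Real.exp (-(n * (t * z.re)))
        ≤ Real.exp n * Real.exp (-(n * t)) := by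
      rw [← Real.exp_add, ← Real.exp_add, Real.exp_le_exp]
      have : 0 ≤ (n : ℝ) * ((1 - t) * (1 - z.re)) := by
        have h1 : 0 ≤ 1 - t := by linarith [ht.2]
        have h2 : 0 ≤ 1 - z.re := by linarith
        positivity
      linarith
    have h2 : 0 ≤ remainderCoeff n * t ^ n * ‖z‖ ^ (n + 1) := by
      have := ht.1
      positivity
    have h3 := mul_le_mul_of_nonneg_left h1 h2
    calc _ = remainderCoeff n * t ^ n * ‖z‖ ^ (n + 1)
          * (Real.exp (n * z.re) * Real.exp (-(n * (t * z.re)))) := by ring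
      _ ≤ _ := h3
      _ = _ := by ring
  have h := image_norm_le_of_norm_deriv_right_le_deriv_boundary (a := 0) (b := 1)
    (fun t _ => (hF' t).continuousAt.continuousWithinAt) (fun t _ => (hF' t).hasDerivWithinAt)
    (by simp [hF, hB, expRemainder_zero]) hB' hbound (Set.right_mem_Icc.2 zero_le_one)
  simp only [hF, hB, Complex.ofReal_one, one_mul] at h
  refine h.trans (mul_le_of_le_one_right (by positivity) (expRemainder_one_re_le n))

theorem norm_normRemainder_le {n : ℕ} (hn : 0 < n) {l : ℂ} (hl : l.re ≤ 0) :
    ‖normRemainder n l‖ ≤ Real.exp n / remainderCoeff n := by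
  have hc := remainderCoeff_pos hn
  have hz : ‖Complex.exp l‖ ≤ 1 := by rw [Complex.norm_exp]; exact Real.exp_le_one_iff.2 hl
  have h := norm_exp_mul_expRemainder_le hn hz
  have e : normRemainder n l = Complex.exp (n * Complex.exp l) * expRemainder n (Complex.exp l)
      * Complex.exp (-((n + 1) * l)) / remainderCoeff n := by
    rw [normRemainder, sub_eq_add_neg, Complex.exp_add]
    ring
  rw [e, norm_div, norm_mul, Complex.norm_real, Real.norm_of_nonneg hc.le]
  gcongr
  have e2 : ‖Complex.exp (-((n + 1) * l))‖ = (‖Complex.exp l‖ ^ (n + 1))⁻¹ := by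
    rw [Complex.exp_neg, norm_inv, ← norm_pow, ← Complex.exp_nat_mul]
    push_cast
    rfl
  have hpos : 0 < ‖Complex.exp l‖ ^ (n + 1) := by
    have := norm_pos_iff.2 (Complex.exp_ne_zero l)
    positivity
  rw [e2, ← div_eq_mul_inv, div_le_iff₀ hpos, mul_comm (Real.exp _)]
  exact h

/-- The differential equation G' = 1 - (n + 1 - n exp l) G makes a very small G move at speed nearly
1. Going a little to the left would then push Re G below 0, against positivity. -/
theorem le_norm_normRemainder {n : ℕ} (hn : 0 < n) {l : ℂ} (hl : l.re ≤ 0) :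
    1 / (16 * (1 + √n + n * ‖1 - Complex.exp l‖)) ≤ ‖normRemainder n l‖ := by
  set M := 1 + √n + n * ‖1 - Complex.exp l‖ with hM
  have hsq : √(n : ℝ) * √n = n := Real.mul_self_sqrt (Nat.cast_nonneg n)
  have hM1 : 1 ≤ M := by
    rw [hM]
    have : 0 ≤ √(n : ℝ) + n * ‖1 - Complex.exp l‖ := by positivity
    linarith
  have hM0 : 0 < M := by linarith
  by_contra! hlt
  set s₁ := 1 / (8 * M) with hs₁
  have hs₁0 : 0 < s₁ := by positivity
  have hsM : s₁ * M = 1 / 8 := by rw [hs₁]; field_simp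
  have hns : n * s₁ ≤ √n := by
    have h1 : √(n : ℝ) ≤ M := by
      rw [hM]
      have : 0 ≤ n * ‖1 - Complex.exp l‖ := by positivity
      linarith
    have h2 : √(n : ℝ) * s₁ ≤ 1 := by nlinarith
    calc n * s₁ = √(n : ℝ) * (√n * s₁) := by rw [← mul_assoc, hsq]
      _ ≤ √(n : ℝ) * 1 := by gcongr
      _ = √n := mul_one _
  have hcoef : ∀ s ∈ Set.Icc 0 s₁, ‖(n : ℂ) + 1 - n * Complex.exp (l - (s : ℂ))‖ ≤ M := by
    intro s hs
    have e : (n : ℂ) + 1 - n * Complex.exp (l - (s : ℂ)) = 1 + n * (1 - Complex.exp l)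
        + n * (Complex.exp l * ((1 - Real.exp (-s) : ℝ) : ℂ)) := by
      rw [sub_eq_add_neg l, Complex.exp_add]
      push_cast
      ring
    have h1 : ‖Complex.exp l‖ ≤ 1 := by rw [Complex.norm_exp]; exact Real.exp_le_one_iff.2 hl
    have h2 : ‖((1 - Real.exp (-s) : ℝ) : ℂ)‖ ≤ s := by
      rw [Complex.norm_real, Real.norm_of_nonneg]
      · linarith [Real.add_one_le_exp (-s)]
      · linarith [Real.exp_le_one_iff.2 (neg_nonpos.2 hs.1)]
    calc _ ≤ ‖(1 : ℂ)‖ + ‖(n : ℂ) * (1 - Complex.exp l)‖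
          + ‖(n : ℂ) * (Complex.exp l * ((1 - Real.exp (-s) : ℝ) : ℂ))‖ := by
            rw [e]; exact norm_add₃_le
      _ ≤ 1 + n * ‖1 - Complex.exp l‖ + n * (1 * s) := by
            rw [norm_mul, norm_mul, norm_mul, Complex.norm_natCast, norm_one]
            gcongr
      _ ≤ 1 + n * ‖1 - Complex.exp l‖ + n * s₁ := by
            rw [one_mul]
            gcongr
            exact hs.2
      _ ≤ M := by rw [hM]; linarith
  set g : ℝ → ℂ := fun s => normRemainder n (l - (s : ℂ)) with hg
  have hder : ∀ s : ℝ, HasDerivAt g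
      (-(1 - (n + 1 - n * Complex.exp (l - (s : ℂ))) * g s)) s := by
    intro s
    have h0 : HasDerivAt (fun s : ℝ => l - (s : ℂ)) (-1) s := by
      simpa using (Complex.ofRealCLM.hasDerivAt (x := s)).const_sub l
    have h1 := (hasDerivAt_normRemainder hn (l - (s : ℂ))).comp s h0
    refine h1.congr_deriv ?_
    rw [mul_neg_one]
  have hcont : ContinuousOn (fun s => ‖g s‖) (Set.Icc 0 s₁) := fun s _ =>
    (hder s).continuousAt.norm.continuousWithinAt
  obtain ⟨s', hs', hmax⟩ := isCompact_Icc.exists_isMaxOn (Set.nonempty_Icc.2 hs₁0.le) hcont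
  set m := ‖g s'‖ with hm
  have hm0 : 0 ≤ m := norm_nonneg _
  have hmax' : ∀ s ∈ Set.Icc 0 s₁, ‖g s‖ ≤ m := fun s hs => hmax hs
  have hprod : ∀ s ∈ Set.Icc 0 s₁,
      ‖((n : ℂ) + 1 - n * Complex.exp (l - (s : ℂ))) * g s‖ ≤ M * m := by
    intro s hs
    rw [norm_mul]
    exact mul_le_mul (hcoef s hs) (hmax' s hs) (norm_nonneg _) hM0.le
  have h1 := norm_image_sub_le_of_norm_deriv_le_segment' (f := g) (a := 0) (b := s₁)
    (C := 1 + M * m) (fun s _ => (hder s).hasDerivWithinAt) (fun s hs => by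
      rw [norm_neg]
      refine (norm_sub_le _ _).trans ?_
      rw [norm_one]
      linarith [hprod s (Set.Ico_subset_Icc_self hs)]) s' hs'
  have hg0 : g 0 = normRemainder n l := by simp [hg]
  have heps : ‖g 0‖ < s₁ / 2 := by
    rw [hg0]
    refine hlt.trans_eq ?_
    rw [hs₁]
    field_simp
    norm_num
  -- With s₁ M = 1/8 this self-bound on the maximum gives M m ≤ 3/14, below 1/4.
  have hm1 : m ≤ s₁ / 2 + (1 + M * m) * s₁ := by
    have h2 : m ≤ ‖g 0‖ + ‖g s' - g 0‖ := by
      rw [hm]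
      calc ‖g s'‖ = ‖g 0 + (g s' - g 0)‖ := by rw [add_sub_cancel]
        _ ≤ _ := norm_add_le _ _
    have h3 : (1 + M * m) * (s' - 0) ≤ (1 + M * m) * s₁ := by
      rw [sub_zero]
      have := hs'.2
      have : 0 ≤ 1 + M * m := by positivity
      gcongr
    linarith
  have hm2 : M * m ≤ 1 / 4 := by nlinarith
  -- Since g + s changes by at most s₁/4, Re g(s₁) < s₁/2 - s₁ + s₁/4 < 0.
  have h2 := norm_image_sub_le_of_norm_deriv_le_segment' (f := fun s : ℝ => g s + (s : ℂ))
    (a := 0) (b := s₁) (C := 1 / 4)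
    (f' := fun s => (n + 1 - n * Complex.exp (l - (s : ℂ))) * g s) (fun s _ => by
      have h0 : HasDerivAt (fun s : ℝ => (s : ℂ)) 1 s := Complex.ofRealCLM.hasDerivAt
      refine (((hder s).add h0).congr_deriv ?_).hasDerivWithinAt
      ring) (fun s hs => (hprod s (Set.Ico_subset_Icc_self hs)).trans hm2) s₁
    (Set.right_mem_Icc.2 hs₁0.le)
  have hre : 0 < (g s₁).re := by
    apply normRemainder_re_pos hn
    rw [Complex.sub_re, Complex.ofReal_re]
    linarith
  have h3 := (Complex.re_le_norm _).trans h2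
  simp only [Complex.sub_re, Complex.add_re, Complex.ofReal_re, Complex.ofReal_zero, sub_zero,
    Complex.zero_re] at h3
  have h4 := (Complex.re_le_norm (g 0))
  simp only [add_zero] at h3
  linarith

/-! ### The phase and its injectivity -/

/-- A logarithm of `expRemainder n (exp l)`. -/
noncomputable def remainderPhase (n : ℕ) (l : ℂ) : ℂ :=
  n * (l - Complex.exp l) + Real.log (remainderCoeff n) + l + Complex.log (normRemainder n l)

theorem normRemainder_ne_zero {n : ℕ} (hn : 0 < n) {l : ℂ} (hl : l.re ≤ 0) :
    normRemainder n l ≠ 0 := by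
  intro h
  have := normRemainder_re_pos hn hl
  rw [h] at this
  simp at this

theorem exp_remainderPhase {n : ℕ} (hn : 0 < n) {l : ℂ} (hl : l.re ≤ 0) :
    Complex.exp (remainderPhase n l) = expRemainder n (Complex.exp l) := by
  rw [remainderPhase, expRemainder_exp hn, Complex.exp_add,
    Complex.exp_log (normRemainder_ne_zero hn hl), add_right_comm, Complex.exp_add _ (Real.log _ : ℂ),
    ← Complex.ofReal_exp, Real.exp_log (remainderCoeff_pos hn)]
  rw [show (n : ℂ) * (l - Complex.exp l) + l = (n + 1) * l - n * Complex.exp l by ring]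
  ring

theorem hasDerivAt_remainderPhase {n : ℕ} (hn : 0 < n) {l : ℂ} (hl : l.re ≤ 0) :
    HasDerivAt (remainderPhase n) (normRemainder n l)⁻¹ l := by
  have hne := normRemainder_ne_zero hn hl
  have h1 := ((((hasDerivAt_id l).sub (Complex.hasDerivAt_exp l)).const_mul (n : ℂ)).add_const
    (Real.log (remainderCoeff n) : ℂ)).add (hasDerivAt_id l)
  have h2 := (hasDerivAt_normRemainder hn l).clog (Or.inl (normRemainder_re_pos hn hl))
  refine (h1.add h2).congr_deriv ?_
  field_simp
  ring

/-- Noshiro–Warschawski argument: on the convex half plane the derivative 1/G has positive real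
part, so the increment along a segment has positive component in the direction of the segment. -/
theorem remainderPhase_sub_re_pos {n : ℕ} (hn : 0 < n) {l l' : ℂ} (hl : l.re ≤ 0)
    (hl' : l'.re ≤ 0) (hne : l ≠ l') :
    0 < (starRingEnd ℂ (l' - l) * (remainderPhase n l' - remainderPhase n l)).re := by
  set d := l' - l with hd
  have hd0 : 0 < Complex.normSq d := Complex.normSq_pos.2 (sub_ne_zero.2 hne.symm)
  set F : ℝ → ℝ := fun t => (starRingEnd ℂ d * remainderPhase n (l + t * d)).re with hF
  have hre : ∀ t ∈ Set.Icc (0 : ℝ) 1, (l + t * d).re ≤ 0 := by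
    intro t ht
    have e : (l + t * d).re = (1 - t) * l.re + t * l'.re := by
      simp [hd]
      ring
    rw [e]
    have h1 : 0 ≤ 1 - t := by linarith [ht.2]
    have h2 := ht.1
    nlinarith
  have hder : ∀ t ∈ Set.Icc (0 : ℝ) 1, HasDerivAt F
      (Complex.normSq d * ((normRemainder n (l + t * d))⁻¹).re) t := by
    intro t ht
    have h0 : HasDerivAt (fun t : ℝ => l + (t : ℂ) * d) d t := by
      simpa using ((Complex.ofRealCLM.hasDerivAt (x := t)).mul_const d).const_add l
    have h1 := Complex.reCLM.hasFDerivAt.comp_hasDerivAt t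
      (((hasDerivAt_remainderPhase hn (hre t ht)).comp t h0).const_mul (starRingEnd ℂ d))
    refine h1.congr_deriv ?_
    rw [Complex.reCLM_apply, ← Complex.re_ofReal_mul, Complex.normSq_eq_conj_mul_self]
    congr 1
    ring
  have hmono : StrictMonoOn F (Set.Icc 0 1) := by
    apply strictMonoOn_of_deriv_pos (convex_Icc 0 1)
      (fun y hy => (hder y hy).continuousAt.continuousWithinAt)
    intro y hy
    rw [interior_Icc] at hy
    have hy' := Set.Ioo_subset_Icc_self hy
    rw [(hder y hy').deriv, Complex.inv_re]
    have h1 := normRemainder_re_pos hn (hre y hy')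
    have h2 := Complex.normSq_pos.2 (normRemainder_ne_zero hn (hre y hy'))
    positivity
  have h := hmono (Set.left_mem_Icc.2 zero_le_one) (Set.right_mem_Icc.2 zero_le_one) zero_lt_one
  simp only [hF, Complex.ofReal_zero, zero_mul, add_zero, Complex.ofReal_one, one_mul] at h
  rw [mul_sub, Complex.sub_re]
  have e : l + d = l' := by rw [hd]; ring
  rw [e] at h
  linarith

theorem remainderPhase_injOn {n : ℕ} (hn : 0 < n) {l l' : ℂ} (hl : l.re ≤ 0)
    (hl' : l'.re ≤ 0) (h : remainderPhase n l = remainderPhase n l') : l = l' := by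
  by_contra hne
  have := remainderPhase_sub_re_pos hn hl hl' hne
  rw [h, sub_self, mul_zero] at this
  simp at this

theorem remainderPhase_ofReal_im {n : ℕ} (hn : 0 < n) {x : ℝ} (hx : x ≤ 0) :
    (remainderPhase n x).im = 0 := by
  have hpos := normRemainder_re_pos hn (l := x) (by simpa using hx)
  have hreal : (normRemainder n x).im = 0 := by
    rw [← Complex.conj_eq_iff_im, ← normRemainder_conj, Complex.conj_ofReal]
  have hG : normRemainder n x = ((normRemainder n x).re : ℂ) := by
    apply Complex.ext <;> simp [hreal]
  have e : remainderPhase n x = ((n * (x - Real.exp x) + Real.log (remainderCoeff n) + x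
      + Real.log (normRemainder n x).re : ℝ) : ℂ) := by
    rw [remainderPhase, hG, ← Complex.ofReal_log hpos.le]
    push_cast
    rfl
  rw [e, Complex.ofReal_im]

theorem remainderPhase_add_two_pi_I (n : ℕ) (l : ℂ) :
    remainderPhase n (l + 2 * Real.pi * Complex.I)
      = remainderPhase n l + (n + 1) * (2 * Real.pi * Complex.I) := by
  have h : Complex.exp (l + 2 * Real.pi * Complex.I) = Complex.exp l := Complex.exp_periodic l
  rw [remainderPhase, remainderPhase, normRemainder_eq_of_exp_eq h, h]
  ring

theorem remainderPhase_im_lt {n : ℕ} (hn : 0 < n) {x y y' : ℝ} (hx : x ≤ 0) (hy : y < y') :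
    (remainderPhase n (x + y * Complex.I)).im < (remainderPhase n (x + y' * Complex.I)).im := by
  have hne : (x : ℂ) + y * Complex.I ≠ x + y' * Complex.I := by
    intro h
    have := congrArg Complex.im h
    simp at this
    exact hy.ne this
  have h := remainderPhase_sub_re_pos hn (by simpa using hx) (by simpa using hx) hne
  have e : (x : ℂ) + y' * Complex.I - (x + y * Complex.I) = ((y' - y : ℝ) : ℂ) * Complex.I := by
    push_cast
    ring
  rw [e, map_mul, Complex.conj_ofReal, Complex.conj_I, mul_assoc, Complex.re_ofReal_mul] at h
  have h2 := (pos_iff_pos_of_mul_pos h).1 (by linarith)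
  simp at h2
  linarith

/-! ### Location and numbering of the zeros -/

/-- The Eneström–Kakeya theorem for nondecreasing coefficients. -/
theorem norm_le_one_of_sum_mul_pow_eq_zero {n : ℕ} {b : ℕ → ℝ} (h0 : 0 ≤ b 0)
    (hmono : ∀ k < n, b k ≤ b (k + 1)) (hpos : 0 < b n) {z : ℂ}
    (hz : ∑ k ∈ Finset.range (n + 1), (b k : ℂ) * z ^ k = 0) : ‖z‖ ≤ 1 := by
  have hid : ∀ n : ℕ, (z - 1) * ∑ k ∈ Finset.range (n + 1), (b k : ℂ) * z ^ k
      = b n * z ^ (n + 1) - (b 0 + ∑ k ∈ Finset.range n, ((b (k + 1) - b k : ℝ) : ℂ) * z ^ (k + 1)) := by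
    intro n
    induction n with
    | zero => simp; ring
    | succ n ih =>
      rw [Finset.sum_range_succ, mul_add, ih, Finset.sum_range_succ _ n]
      push_cast
      ring
  have h := hid n
  rw [hz, mul_zero, eq_comm, sub_eq_zero] at h
  by_contra! hlt
  have hle : ‖(b 0 : ℂ) + ∑ k ∈ Finset.range n, ((b (k + 1) - b k : ℝ) : ℂ) * z ^ (k + 1)‖
      ≤ b 0 * ‖z‖ ^ n + ∑ k ∈ Finset.range n, (b (k + 1) - b k) * ‖z‖ ^ n := by
    refine (norm_add_le _ _).trans (add_le_add ?_ ?_)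
    · rw [Complex.norm_real, Real.norm_of_nonneg h0]
      exact le_mul_of_one_le_right h0 (one_le_pow₀ hlt.le)
    · refine (norm_sum_le _ _).trans (Finset.sum_le_sum fun k hk => ?_)
      rw [Finset.mem_range] at hk
      have hk' : 0 ≤ b (k + 1) - b k := sub_nonneg.2 (hmono k hk)
      rw [norm_mul, Complex.norm_real, Real.norm_of_nonneg hk', norm_pow]
      exact mul_le_mul_of_nonneg_left (pow_le_pow_right₀ hlt.le hk) hk'
  rw [← Finset.sum_mul, Finset.sum_range_sub, ← add_mul, add_sub_cancel, ← h, norm_mul, norm_pow,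
    Complex.norm_real, Real.norm_of_nonneg hpos.le, pow_succ] at hle
  have hp : 0 < b n * ‖z‖ ^ n := by
    have : 0 < ‖z‖ := by linarith
    positivity
  nlinarith

theorem norm_le_one_of_truncExp_eq_zero {n : ℕ} (hn : 0 < n) {z : ℂ}
    (hz : truncExp n (n * z) = 0) : ‖z‖ ≤ 1 := by
  apply norm_le_one_of_sum_mul_pow_eq_zero (n := n) (b := fun k => (n : ℝ) ^ k / k.factorial)
  · simp
  · intro k hk
    rw [Nat.factorial_succ, pow_succ, Nat.cast_mul, mul_comm (((k + 1 : ℕ)) : ℝ), mul_div_mul_comm]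
    apply le_mul_of_one_le_right (by positivity)
    rw [one_le_div (by positivity)]
    exact_mod_cast hk
  · positivity
  · rw [← hz, truncExp]
    apply Finset.sum_congr rfl
    intro k _
    push_cast
    rw [mul_pow]
    ring

theorem truncExp_ofReal_ne_zero (n : ℕ) {x : ℝ} (hx : 0 < x) : truncExp n x ≠ 0 := by
  have h : truncExp n x = ((∑ k ∈ Finset.range (n + 1), x ^ k / k.factorial : ℝ) : ℂ) := by
    simp [truncExp]
  rw [h]
  have : 0 < ∑ k ∈ Finset.range (n + 1), x ^ k / (k.factorial : ℝ) :=
    Finset.sum_pos (fun k _ => by positivity) (by simp)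
  exact_mod_cast this.ne'

/-- Every zero of `truncExp n (n z)` is `exp l` with `l` at one of `n` levels of the phase. -/
theorem exists_log_of_truncExp_eq_zero {n : ℕ} (hn : 0 < n) {z : ℂ}
    (hz : truncExp n (n * z) = 0) :
    ∃ (l : ℂ) (k : ℕ), Complex.exp l = z ∧ l.re ≤ 0 ∧ 0 < l.im ∧ l.im < 2 * Real.pi ∧
      k ∈ Finset.Icc 1 n ∧ remainderPhase n l = k * (2 * Real.pi * Complex.I) := by
  have hz0 : z ≠ 0 := by
    rintro rfl
    simp [truncExp, Finset.sum_range_succ'] at hz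
  have hpi := Real.pi_pos
  -- This branch has imaginary part in (0, 2π]; the value 2π is excluded because the truncated
  -- series is positive on the positive axis.
  set l : ℂ := Complex.log (-z) + Real.pi * Complex.I with hl
  have hexp : Complex.exp l = z := by
    rw [hl, Complex.exp_add, Complex.exp_log (neg_ne_zero.2 hz0), Complex.exp_pi_mul_I]
    ring
  have him : l.im = (Complex.log (-z)).im + Real.pi := by simp [hl]
  have hre : l.re ≤ 0 := by
    have h1 := norm_le_one_of_truncExp_eq_zero hn hz
    rw [← hexp, Complex.norm_exp] at h1
    exact Real.exp_le_one_iff.1 h1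
  have h0 : 0 < l.im := by linarith [Complex.neg_pi_lt_log_im (-z)]
  have h2 : l.im < 2 * Real.pi := by
    apply lt_of_le_of_ne
    · linarith [Complex.log_im_le_pi (-z)]
    · intro h
      apply truncExp_ofReal_ne_zero n (x := n * Real.exp l.re) (by positivity)
      rw [← hz]
      congr 1
      rw [← hexp, Complex.exp_eq_exp_re_mul_sin_add_cos, h]
      simp
  have hR : Complex.exp (remainderPhase n l) = 1 := by
    rw [exp_remainderPhase hn hre, hexp, expRemainder, hz]
    simp
  obtain ⟨k, hk⟩ := Complex.exp_eq_one_iff.1 hR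
  have hkim : (remainderPhase n l).im = k * (2 * Real.pi) := by
    rw [hk]
    simp
  have e1 : (l.re : ℂ) + l.im * Complex.I = l := Complex.re_add_im l
  -- The imaginary part of the phase is 0 at height 0 and 2π(n + 1) at height 2π, and strictly
  -- increasing between, so 0 < k < n + 1.
  have hlow := remainderPhase_im_lt hn hre h0
  rw [e1, Complex.ofReal_zero, zero_mul, add_zero, remainderPhase_ofReal_im hn hre, hkim] at hlow
  have hup := remainderPhase_im_lt hn hre h2
  have e2 : (l.re : ℂ) + (2 * Real.pi : ℝ) * Complex.I = l.re + 2 * Real.pi * Complex.I := by simp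
  rw [e1, e2, remainderPhase_add_two_pi_I, hkim, Complex.add_im,
    remainderPhase_ofReal_im hn hre] at hup
  have e3 : (((n : ℂ) + 1) * (2 * Real.pi * Complex.I)).im = (n + 1) * (2 * Real.pi) := by simp
  rw [e3, zero_add] at hup
  have hk0 : (0 : ℝ) < k := (pos_iff_pos_of_mul_pos hlow).2 (by positivity)
  have hk1 : (k : ℝ) < n + 1 := lt_of_mul_lt_mul_right hup (by positivity)
  have hk0' : 0 < k := by exact_mod_cast hk0
  have hk1' : k < n + 1 := by exact_mod_cast hk1
  lift k to ℕ using hk0'.le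
  refine ⟨l, k, hexp, hre, h0, h2, ?_, by simpa using hk⟩
  rw [Finset.mem_Icc]
  omega

open Polynomial in
/-- The reversed truncated exponential polynomial. -/
noncomputable def revTruncExp (n : ℕ) : ℂ[X] :=
  ∑ j ∈ Finset.range (n + 1), C ((-(n : ℂ)) ^ j / j.factorial) * X ^ (n - j)

theorem revTruncExp_eval {n : ℕ} {y : ℂ} (hy : y ≠ 0) :
    (revTruncExp n).eval y = y ^ n * truncExp n (n * (-y⁻¹)) := by
  rw [revTruncExp, truncExp, Polynomial.eval_finsetSum, Finset.mul_sum]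
  apply Finset.sum_congr rfl
  intro j hj
  rw [Finset.mem_range] at hj
  obtain ⟨i, rfl⟩ := Nat.exists_eq_add_of_le (Nat.le_of_lt_succ hj)
  simp only [Polynomial.eval_mul, Polynomial.eval_C, Polynomial.eval_pow, Polynomial.eval_X,
    Nat.add_sub_cancel_left]
  rw [show (((j + i : ℕ)) : ℂ) * -y⁻¹ = (-((j + i : ℕ) : ℂ)) * y⁻¹ by ring, mul_pow, inv_pow, pow_add]
  field_simp

theorem revTruncExp_eval_zero_ne_zero {n : ℕ} (hn : 0 < n) : (revTruncExp n).eval 0 ≠ 0 := by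
  rw [revTruncExp, Polynomial.eval_finsetSum, Finset.sum_range_succ, Finset.sum_eq_zero]
  · have h1 : (n : ℂ) ≠ 0 := by exact_mod_cast hn.ne'
    have h2 : (n.factorial : ℂ) ≠ 0 := by exact_mod_cast n.factorial_ne_zero
    simp [h1, h2]
  · intro j hj
    rw [Finset.mem_range] at hj
    simp [show n - j ≠ 0 by omega]

open Polynomial in
theorem revTruncExp_monic_natDegree (n : ℕ) :
    (revTruncExp n).Monic ∧ (revTruncExp n).natDegree = n := by
  have hlt : (∑ j ∈ Finset.range n,
      C ((-(n : ℂ)) ^ (j + 1) / (j + 1).factorial) * X ^ (n - (j + 1)) : ℂ[X]).degree < n := by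
    refine (degree_sum_le _ _).trans_lt ((Finset.sup_lt_iff (WithBot.bot_lt_coe n)).2 ?_)
    intro j hj
    rw [Finset.mem_range] at hj
    refine (degree_C_mul_X_pow_le _ _).trans_lt ?_
    exact Nat.cast_lt.2 (by omega)
  have he : revTruncExp n = X ^ n + ∑ j ∈ Finset.range n,
      C ((-(n : ℂ)) ^ (j + 1) / (j + 1).factorial) * X ^ (n - (j + 1)) := by
    rw [revTruncExp, Finset.sum_range_succ', add_comm]
    simp
  rw [he]
  refine ⟨monic_X_pow_add hlt, ?_⟩
  rw [natDegree_add_eq_left_of_degree_lt (by rwa [degree_X_pow]), natDegree_X_pow]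

/-- At a zero w of the truncated series its derivative is -w^n / n!, which is nonzero. -/
theorem revTruncExp_roots_nodup {n : ℕ} (hn : 0 < n) : (revTruncExp n).roots.Nodup := by
  have hne : revTruncExp n ≠ 0 := (revTruncExp_monic_natDegree n).1.ne_zero
  rw [Multiset.nodup_iff_count_le_one]
  intro y
  rw [Polynomial.count_roots]
  by_contra! hlt
  obtain ⟨h1, h0⟩ := (Polynomial.one_lt_rootMultiplicity_iff_isRoot hne).1 hlt
  have hy : y ≠ 0 := by
    rintro rfl
    exact revTruncExp_eval_zero_ne_zero hn h1
  have hT : truncExp n (n * (-y⁻¹)) = 0 := by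
    have := revTruncExp_eval (n := n) hy
    rw [show (revTruncExp n).eval y = 0 from h1] at this
    exact (mul_eq_zero.1 this.symm).resolve_left (pow_ne_zero _ hy)
  have hd1 : HasDerivAt (fun y => (revTruncExp n).eval y) 0 y := by
    have := (revTruncExp n).hasDerivAt y
    rwa [show (revTruncExp n).derivative.eval y = 0 from h0] at this
  have hin : HasDerivAt (fun y : ℂ => (n : ℂ) * (-y⁻¹)) (n * (y ^ 2)⁻¹) y := by
    have := ((hasDerivAt_inv hy).neg).const_mul (n : ℂ)
    simpa using this
  have hd2 := (hasDerivAt_pow n y).mul ((hasDerivAt_truncExp n (n * (-y⁻¹))).comp y hin)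
  have heq : (fun y => (revTruncExp n).eval y)
      =ᶠ[nhds y] ((fun y => y ^ n) * (truncExp n ∘ fun y : ℂ => (n : ℂ) * (-y⁻¹))) := by
    filter_upwards [isOpen_ne.mem_nhds hy] with x hx
    exact revTruncExp_eval hx
  have := (hd1.congr_of_eventuallyEq heq.symm).unique hd2
  simp only [Function.comp, hT] at this
  have h2 : (n.factorial : ℂ) ≠ 0 := by exact_mod_cast n.factorial_ne_zero
  have h3 : (n : ℂ) ≠ 0 := by exact_mod_cast hn.ne'
  rw [mul_zero, zero_add, zero_sub, eq_comm] at this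
  simp [hy, h2, h3] at this

open Polynomial in
/-- The factorization of `revTruncExp`, its roots being numbered by the level of the phase. -/
theorem exists_revTruncExp_eq_prod {n : ℕ} (hn : 0 < n) :
    ∃ l : ℕ → ℂ, (∀ t ∈ Finset.Icc 1 n, (l t).re ≤ 0 ∧ 0 < (l t).im ∧ (l t).im < 2 * Real.pi ∧
        remainderPhase n (l t) = t * (2 * Real.pi * Complex.I)) ∧
      revTruncExp n = ∏ t ∈ Finset.Icc 1 n, (X - C (-(Complex.exp (l t))⁻¹)) := by
  classical
  obtain ⟨hmonic, hdeg⟩ := revTruncExp_monic_natDegree n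
  have hex : ∀ y ∈ (revTruncExp n).roots.toFinset, ∃ (l : ℂ) (k : ℕ), y = -(Complex.exp l)⁻¹ ∧
      l.re ≤ 0 ∧ 0 < l.im ∧ l.im < 2 * Real.pi ∧ k ∈ Finset.Icc 1 n ∧
      remainderPhase n l = k * (2 * Real.pi * Complex.I) := by
    intro y hy
    rw [Multiset.mem_toFinset, mem_roots hmonic.ne_zero, IsRoot.def] at hy
    have hy0 : y ≠ 0 := by
      rintro rfl
      exact revTruncExp_eval_zero_ne_zero hn hy
    rw [revTruncExp_eval hy0] at hy
    obtain ⟨l, k, h1, h2⟩ := exists_log_of_truncExp_eq_zero hn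
      ((mul_eq_zero.1 hy).resolve_left (pow_ne_zero _ hy0))
    refine ⟨l, k, ?_, h2⟩
    rw [h1]
    simp
  choose! l k hy hre him0 him hk hph using hex
  have hcard : (revTruncExp n).roots.toFinset.card = n := by
    rw [Multiset.toFinset_card_of_nodup (revTruncExp_roots_nodup hn),
      ← (IsAlgClosed.splits (revTruncExp n)).natDegree_eq_card_roots, hdeg]
  have hinj : Set.InjOn k (revTruncExp n).roots.toFinset := by
    intro a ha b hb hab
    rw [hy a ha, hy b hb]
    congr 3
    apply remainderPhase_injOn hn (hre a ha) (hre b hb)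
    rw [hph a ha, hph b hb, hab]
  -- An injection of n roots into n levels is onto.
  have himage : (revTruncExp n).roots.toFinset.image k = Finset.Icc 1 n := by
    apply Finset.eq_of_subset_of_card_le
    · intro t ht
      obtain ⟨y, hy, rfl⟩ := Finset.mem_image.1 ht
      exact hk y hy
    · rw [Finset.card_image_of_injOn hinj, hcard, Nat.card_Icc]
      omega
  have hsurj : ∀ t ∈ Finset.Icc 1 n, ∃ y ∈ (revTruncExp n).roots.toFinset, k y = t := by
    intro t ht
    rw [← himage] at ht
    exact Finset.mem_image.1 ht
  choose! y hyr hky using hsurj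
  refine ⟨fun t => l (y t), fun t ht => ⟨hre _ (hyr t ht), him0 _ (hyr t ht), him _ (hyr t ht), ?_⟩, ?_⟩
  · rw [hph _ (hyr t ht), hky t ht]
  · have h1 : revTruncExp n = ((revTruncExp n).roots.map fun a => X - C a).prod :=
      (prod_multiset_X_sub_C_of_monic_of_roots_card_eq hmonic
        (IsAlgClosed.splits _).natDegree_eq_card_roots.symm).symm
    have h2 : ((revTruncExp n).roots.map fun a => X - C a).prod
        = ∏ a ∈ (revTruncExp n).roots.toFinset, (X - C a) := by
      rw [Finset.prod, Multiset.toFinset_val, (revTruncExp_roots_nodup hn).dedup]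
    rw [h1, h2]
    apply Finset.prod_bij' (fun a _ => k a) (fun t _ => y t)
    · exact hk
    · exact hyr
    · intro a ha
      exact hinj (hyr _ (hk a ha)) ha (hky _ (hk a ha))
    · exact hky
    · intro a ha
      have : y (k a) = a := hinj (hyr _ (hk a ha)) ha (hky _ (hk a ha))
      dsimp only
      rw [this, ← hy a ha]

/-! ### The principal branch of Lambert W on the circle of radius 1/e -/

/-- The cotangent inequality in the definition of the range fixes the sign of |w| sin(arg w + Im w),
which excludes a sum beyond ±π. Thus log(w exp w) = log w + w without a correction. -/
theorem arg_add_im_mem_Ioc {w : ℂ} (hw : w ∈ lambertWRange) (h0 : w ≠ 0) :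
    w.arg + w.im ∈ Set.Ioc (-Real.pi) Real.pi := by
  have hr : 0 < ‖w‖ := norm_pos_iff.2 h0
  have hre : w.re = ‖w‖ * Real.cos w.arg := (Complex.norm_mul_cos_arg w).symm
  have him : w.im = ‖w‖ * Real.sin w.arg := (Complex.norm_mul_sin_arg w).symm
  have hsin : w.im * Real.cos w.im + w.re * Real.sin w.im = ‖w‖ * Real.sin (w.arg + w.im) := by
    rw [Real.sin_add, mul_add, ← mul_assoc, ← mul_assoc, ← him, ← hre]
  rcases hw with ⟨h, _⟩ | ⟨h1, h2, h3⟩ | ⟨h1, h2, h3⟩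
  · rw [h, add_zero]
    exact Complex.arg_mem_Ioc w
  · have ha : 0 ≤ w.arg := Complex.arg_nonneg_iff.2 h1.le
    refine ⟨by linarith [Real.pi_pos], ?_⟩
    by_contra! hlt
    have hs : 0 < Real.sin w.im := Real.sin_pos_of_pos_of_lt_pi h1 h2
    have hneg : Real.sin (w.arg + w.im) < 0 := by
      rw [← Real.sin_sub_two_pi]
      apply Real.sin_neg_of_neg_of_neg_pi_lt <;> linarith [Complex.arg_le_pi w]
    rw [Real.cot_eq_cos_div_sin] at h3
    have h4 : 0 ≤ w.im * Real.cos w.im + w.re * Real.sin w.im := by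
      have := mul_le_mul_of_nonneg_right h3 hs.le
      rw [neg_mul, mul_assoc, div_mul_cancel₀ _ hs.ne'] at this
      linarith
    rw [hsin] at h4
    exact absurd (mul_neg_of_pos_of_neg hr hneg) (not_lt.2 h4)
  · have ha : w.arg < 0 := Complex.arg_neg_iff.2 h2
    refine ⟨?_, by linarith [Real.pi_pos]⟩
    by_contra! hlt
    have hs : Real.sin w.im < 0 := Real.sin_neg_of_neg_of_neg_pi_lt h2 h1
    have hpos : 0 ≤ Real.sin (w.arg + w.im) := by
      rw [← Real.sin_add_two_pi]
      apply Real.sin_nonneg_of_nonneg_of_le_pi <;> linarith [Complex.neg_pi_lt_arg w]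
    rw [Real.cot_eq_cos_div_sin] at h3
    have h4 : w.im * Real.cos w.im + w.re * Real.sin w.im < 0 := by
      have := mul_lt_mul_of_neg_right h3 hs
      rw [neg_mul, mul_assoc, div_mul_cancel₀ _ hs.ne] at this
      linarith
    rw [hsin] at h4
    exact absurd (mul_nonneg hr.le hpos) (not_le.2 h4)

theorem log_mul_exp_of_mem_lambertWRange {w : ℂ} (hw : w ∈ lambertWRange) (h0 : w ≠ 0) :
    Complex.log (w * Complex.exp w) = Complex.log w + w := by
  have h := arg_add_im_mem_Ioc hw h0
  have e : w * Complex.exp w = Complex.exp (Complex.log w + w) := by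
    rw [Complex.exp_add, Complex.exp_log h0]
  rw [e, Complex.log_exp]
  · rw [Complex.add_im, Complex.log_im]
    exact h.1
  · rw [Complex.add_im, Complex.log_im]
    exact h.2

/-- With w = -z, the equation asks for z exp(-z) of argument θ and modulus 1/e. The argument is
right along `steepestCurve θ`, and the modulus is met by the intermediate value theorem. -/
theorem exists_lower_lambertW {θ : ℝ} (h0 : 0 < θ) (hpi : θ < Real.pi) :
    ∃ w : ℂ, (-Real.pi < w.im ∧ w.im < 0 ∧ -(w.im * Real.cot w.im) < w.re) ∧
      w * Complex.exp w = -Complex.exp (θ * Complex.I - 1) := by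
  set ψ : ℝ → ℝ := fun y => (y - θ) / Real.sin y
    * Real.exp (-((y - θ) * (Real.cos y / Real.sin y))) * Real.exp 1 with hψ
  -- At the midpoint π - y₁ = y₁ - θ, so sin y₁ ≤ y₁ - θ, while cos y₁ ≤ 0; both push ψ above 1.
  set y₁ := (Real.pi + θ) / 2 with hy₁
  have hsin : ∀ y ∈ Set.Icc θ y₁, 0 < Real.sin y := fun y hy =>
    Real.sin_pos_of_pos_of_lt_pi (by linarith [hy.1]) (by linarith [hy.2])
  have hcont : ContinuousOn ψ (Set.Icc θ y₁) := by
    have hne : ∀ y ∈ Set.Icc θ y₁, Real.sin y ≠ 0 := fun y hy => (hsin y hy).ne'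
    have hid : ContinuousOn (fun y : ℝ => y - θ) (Set.Icc θ y₁) := by fun_prop
    have hs : ContinuousOn Real.sin (Set.Icc θ y₁) := Real.continuous_sin.continuousOn
    have hc : ContinuousOn Real.cos (Set.Icc θ y₁) := Real.continuous_cos.continuousOn
    exact ((hid.div hs hne).mul (hid.mul (hc.div hs hne)).neg.rexp).mul continuousOn_const
  have hle : θ ≤ y₁ := by rw [hy₁]; linarith
  have hψ0 : ψ θ = 0 := by simp [hψ]
  have hψ1 : 1 ≤ ψ y₁ := by
    have hs := hsin y₁ (Set.right_mem_Icc.2 hle)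
    have h1 : Real.sin y₁ ≤ y₁ - θ := by
      rw [← Real.sin_pi_sub]
      calc Real.sin (Real.pi - y₁) ≤ Real.pi - y₁ := Real.sin_le (by linarith)
        _ = y₁ - θ := by rw [hy₁]; ring
    have h2 : Real.cos y₁ ≤ 0 :=
      Real.cos_nonpos_of_pi_div_two_le_of_le (by linarith) (by linarith)
    have h3 : 1 ≤ (y₁ - θ) / Real.sin y₁ := (one_le_div hs).2 h1
    have h4 : 1 ≤ Real.exp (-((y₁ - θ) * (Real.cos y₁ / Real.sin y₁))) := by
      rw [Real.one_le_exp_iff, neg_nonneg]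
      exact mul_nonpos_of_nonneg_of_nonpos (by linarith) (div_nonpos_of_nonpos_of_nonneg h2 hs.le)
    have h5 : (1 : ℝ) ≤ Real.exp 1 := Real.one_le_exp_iff.2 zero_le_one
    exact one_le_mul_of_one_le_of_one_le (one_le_mul_of_one_le_of_one_le h3 h4) h5
  obtain ⟨y, hy, hy1⟩ := intermediate_value_Icc hle hcont (show (1 : ℝ) ∈ Set.Icc (ψ θ) (ψ y₁) from
    ⟨by rw [hψ0]; exact zero_le_one, hψ1⟩)
  have hθy : θ < y := by
    apply lt_of_le_of_ne hy.1
    rintro rfl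
    rw [hψ0] at hy1
    exact zero_ne_one hy1
  have hs := hsin y hy
  have hyπ : y < Real.pi := by linarith [hy.2]
  refine ⟨-steepestCurve θ y, ?_, ?_⟩
  · have him : (-steepestCurve θ y).im = -(y - θ) := by
      rw [steepestCurve, Complex.neg_im, Complex.add_im, Complex.ofReal_im, Complex.im_ofReal_mul,
        Complex.I_im, zero_add, mul_one]
    have hre : (-steepestCurve θ y).re = -((y - θ) * (Real.cos y / Real.sin y)) := by
      rw [steepestCurve, Complex.neg_re, Complex.add_re, Complex.ofReal_re, Complex.re_ofReal_mul,
        Complex.I_re, mul_zero, add_zero]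
    rw [him, hre]
    refine ⟨by linarith, by linarith, ?_⟩
    have hsη : 0 < Real.sin (y - θ) :=
      Real.sin_pos_of_pos_of_lt_pi (by linarith) (by linarith)
    rw [Real.cot_eq_cos_div_sin, Real.cos_neg, Real.sin_neg, div_neg, neg_mul_neg, neg_lt_neg_iff]
    apply mul_lt_mul_of_pos_left _ (by linarith)
    rw [div_lt_div_iff₀ hs hsη]
    have h1 : Real.sin (y - (y - θ)) = Real.sin y * Real.cos (y - θ) - Real.cos y * Real.sin (y - θ) :=
      Real.sin_sub _ _
    rw [sub_sub_cancel] at h1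
    have h2 : 0 < Real.sin θ := Real.sin_pos_of_pos_of_lt_pi h0 hpi
    linarith
  · have hρ : (y - θ) / Real.sin y * Real.exp (-((y - θ) * (Real.cos y / Real.sin y)))
        = Real.exp (-1) := by
      have h1 : Real.exp 1 * Real.exp (-1) = 1 := by rw [← Real.exp_add]; simp
      calc _ = ψ y * Real.exp (-1) := by rw [hψ]; simp only; rw [mul_assoc _ (Real.exp 1), h1, mul_one]
        _ = _ := by rw [hy1, one_mul]
    rw [neg_mul, steepestCurve_mul_exp_neg hs.ne', hρ, Complex.ofReal_exp, ← Complex.exp_add]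
    congr 2
    push_cast
    ring

theorem exists_mem_lambertWRange {θ : ℝ} (h0 : 0 < θ) (h2 : θ < 2 * Real.pi) :
    ∃ w : ℂ, w ∈ lambertWRange ∧ w * Complex.exp w = -Complex.exp (θ * Complex.I - 1) := by
  rcases lt_trichotomy θ Real.pi with h | h | h
  · obtain ⟨w, hw, he⟩ := exists_lower_lambertW h0 h
    exact ⟨w, Or.inr (Or.inr hw), he⟩
  · have hcont : ContinuousOn (fun x : ℝ => x * Real.exp x) (Set.Icc 0 1) := by fun_prop
    have h01 : Real.exp (-1) ∈ Set.Icc ((0 : ℝ) * Real.exp 0) (1 * Real.exp 1) := by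
      rw [zero_mul, one_mul]
      exact ⟨(Real.exp_pos _).le, Real.exp_le_exp.2 (by norm_num)⟩
    obtain ⟨x, hx, he⟩ := intermediate_value_Icc zero_le_one hcont h01
    refine ⟨x, Or.inl ⟨Complex.ofReal_im x, ?_⟩, ?_⟩
    · rw [Complex.ofReal_re]
      linarith [hx.1]
    · dsimp only at he
      rw [h, ← Complex.ofReal_exp, ← Complex.ofReal_mul, he, Complex.exp_sub, Complex.exp_pi_mul_I,
        Real.exp_neg, Complex.ofReal_inv, Complex.ofReal_exp, Complex.ofReal_one, neg_div, neg_neg,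
        one_div]
  · obtain ⟨w, ⟨h1, h2, h3⟩, he⟩ := exists_lower_lambertW (θ := 2 * Real.pi - θ) (by linarith)
      (by linarith)
    refine ⟨starRingEnd ℂ w, Or.inr (Or.inl ⟨?_, ?_, ?_⟩), ?_⟩
    · rw [Complex.conj_im]; linarith
    · rw [Complex.conj_im]; linarith
    · rw [Complex.conj_im, Complex.conj_re]
      rw [Real.cot_eq_cos_div_sin] at h3 ⊢
      rw [Real.cos_neg, Real.sin_neg, div_neg, neg_mul_neg]
      exact h3.le
    · rw [Complex.exp_conj, ← map_mul, he, map_neg, ← Complex.exp_conj]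
      congr 1
      have e : starRingEnd ℂ (((2 * Real.pi - θ : ℝ) : ℂ) * Complex.I - 1)
          = (θ * Complex.I - 1) - 2 * Real.pi * Complex.I := by
        rw [map_sub, map_mul, Complex.conj_ofReal, Complex.conj_I, map_one]
        push_cast
        ring
      rw [e, Complex.exp_sub, Complex.exp_two_pi_mul_I, div_one]

/-- Put ψ = π - Y. If X ≥ 0, then tan ψ > ψ gives exp X sin ψ > ψ exp X cos ψ = ψ(1 + X) ≥ ψ,
against `h2`. -/
theorem neg_of_lambert_eqs_of_nonneg {X Y : ℝ} (hY0 : 0 ≤ Y) (hYπ : Y ≤ Real.pi)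
    (h1 : X + Real.exp X * Real.cos Y = -1) (h2 : Y + Real.exp X * Real.sin Y < Real.pi) :
    X < 0 := by
  by_contra! hX
  set ψ := Real.pi - Y with hψ
  have hY : Y = Real.pi - ψ := by rw [hψ]; ring
  rw [hY, Real.cos_pi_sub] at h1
  rw [hY, Real.sin_pi_sub] at h2
  have he := Real.exp_pos X
  have hcos : 0 < Real.cos ψ := by
    by_contra! hc
    nlinarith
  have hψ0 : 0 < ψ := by
    rcases (show 0 ≤ ψ by linarith).eq_or_lt with h | h
    · rw [← h] at h2
      simp at h2
    · exact h
  have hψ2 : ψ < Real.pi / 2 := by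
    by_contra! hlt
    exact absurd (Real.cos_nonpos_of_pi_div_two_le_of_le hlt (by linarith)) (not_le.2 hcos)
  have htan := Real.lt_tan hψ0 hψ2
  rw [Real.tan_eq_sin_div_cos, lt_div_iff₀ hcos] at htan
  nlinarith [mul_lt_mul_of_pos_left htan he, mul_nonneg hψ0.le hX]

/-- The equations of the Szegő curve, in logarithmic coordinates `X + i Y` of the Lambert value,
bound the distance `-X` to the branch point from below and the angle to it from above. -/
theorem lambert_bounds_of_nonneg {X Y : ℝ} (hY0 : 0 ≤ Y) (hYπ : Y ≤ Real.pi)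
    (h1 : X + Real.exp X * Real.cos Y = -1) (h2 : Y + Real.exp X * Real.sin Y < Real.pi) :
    X < 0 ∧ -2 ≤ X ∧ 1 + Real.cos Y ≤ 8 * X ^ 2 ∧
      Real.pi - (Y + Real.exp X * Real.sin Y) ≤ 34 * Real.pi * X ^ 2 := by
  have hX := neg_of_lambert_eqs_of_nonneg hY0 hYπ h1 h2
  have he := Real.exp_pos X
  have he1 : Real.exp X < 1 := by rw [← Real.exp_zero]; exact Real.exp_lt_exp.2 hX
  have hpi := Real.pi_pos
  have hX2 : -2 ≤ X := by nlinarith [Real.cos_le_one Y]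
  set ψ := Real.pi - Y with hψ
  have hY : Y = Real.pi - ψ := by rw [hψ]; ring
  have hψ0 : 0 ≤ ψ := by linarith
  have hψπ : ψ ≤ Real.pi := by linarith
  rw [hY, Real.cos_pi_sub] at h1 ⊢
  rw [Real.sin_pi_sub]
  have hee : Real.exp X * Real.exp (-X) = 1 := by rw [← Real.exp_add]; simp
  have hcos : Real.cos ψ = (1 + X) * Real.exp (-X) := by
    have : Real.exp X * Real.cos ψ = 1 + X := by linarith
    calc Real.cos ψ = (Real.exp X * Real.exp (-X)) * Real.cos ψ := by rw [hee, one_mul]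
      _ = (Real.exp X * Real.cos ψ) * Real.exp (-X) := by ring
      _ = _ := by rw [this]
  have hexp8 : Real.exp (-X) ≤ 8 := by
    have h3 : Real.exp (-X) ≤ Real.exp 2 := Real.exp_le_exp.2 (by linarith)
    have h4 : Real.exp 2 = Real.exp 1 * Real.exp 1 := by rw [← Real.exp_add]; norm_num
    nlinarith [Real.exp_one_lt_d9, Real.exp_pos 1]
  have hX1 : 1 + X ≤ Real.exp X := by linarith [Real.add_one_le_exp X]
  have hcos8 : 1 - Real.cos ψ ≤ 8 * X ^ 2 := by
    have h3 : 1 - X ≤ Real.exp (-X) := by linarith [Real.add_one_le_exp (-X)]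
    have h4 : Real.exp (-X) - 1 ≤ -X * Real.exp (-X) := by
      have := mul_le_mul_of_nonneg_right hX1 (Real.exp_pos (-X)).le
      rw [hee] at this
      linarith
    rw [hcos]
    nlinarith
  have hψB : ψ ≤ 2 * Real.pi * (-X) := by
    have h3 : Real.cos ψ ≤ 1 - 2 / Real.pi ^ 2 * ψ ^ 2 :=
      Real.cos_le_one_sub_mul_cos_sq (by rwa [abs_of_nonneg hψ0])
    have h4 : 2 / Real.pi ^ 2 * ψ ^ 2 ≤ 8 * X ^ 2 := by linarith
    have h5 : ψ ^ 2 ≤ (2 * Real.pi * (-X)) ^ 2 := by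
      rw [div_mul_eq_mul_div, div_le_iff₀ (by positivity)] at h4
      nlinarith
    exact le_of_sq_le_sq h5 (by nlinarith)
  refine ⟨hX, hX2, by linarith, ?_⟩
  have hsin0 : 0 ≤ Real.sin ψ := Real.sin_nonneg_of_nonneg_of_le_pi hψ0 hψπ
  have hsc : ψ * Real.cos ψ ≤ Real.sin ψ := by
    rcases le_or_gt (Real.pi / 2) ψ with h | h
    · have := Real.cos_nonpos_of_pi_div_two_le_of_le h (by linarith)
      nlinarith
    · have hc : 0 < Real.cos ψ := Real.cos_pos_of_mem_Ioo ⟨by linarith, h⟩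
      have := Real.le_tan hψ0 h
      rwa [Real.tan_eq_sin_div_cos, le_div_iff₀ hc] at this
  have hss : Real.sin ψ ≤ ψ := Real.sin_le hψ0
  -- The angle is (ψ - sin ψ) + (1 - exp X) sin ψ. With ψ ≤ 2π(-X) and -X ≤ 2 the two parts cost
  -- 32πX² and 2πX².
  have h3 : ψ - Real.sin ψ ≤ ψ * (8 * X ^ 2) := by nlinarith
  have h4 : (1 - Real.exp X) * Real.sin ψ ≤ -X * ψ :=
    mul_le_mul (by linarith) hss hsin0 (by linarith)
  have h5 : ψ * (8 * X ^ 2) ≤ 2 * Real.pi * (-X) * (8 * X ^ 2) := by gcongr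
  have h6 : -X * ψ ≤ -X * (2 * Real.pi * (-X)) := by
    have : 0 ≤ -X := by linarith
    gcongr
  have h7 : 2 * Real.pi * (-X) * (8 * X ^ 2) ≤ 32 * Real.pi * X ^ 2 := by
    nlinarith [mul_nonneg hpi.le (sq_nonneg X)]
  linarith

theorem lambert_bounds {X Y : ℝ} (hY : |Y| ≤ Real.pi)
    (h1 : X + Real.exp X * Real.cos Y = -1) (h2 : |Y + Real.exp X * Real.sin Y| < Real.pi) :
    X < 0 ∧ -2 ≤ X ∧ 1 + Real.cos Y ≤ 8 * X ^ 2 ∧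
      Real.pi - |Y + Real.exp X * Real.sin Y| ≤ 34 * Real.pi * X ^ 2 := by
  have habs : |Y| + Real.exp X * Real.sin |Y| = |Y + Real.exp X * Real.sin Y| := by
    rcases le_total 0 Y with h | h
    · have hY' := abs_of_nonneg h
      rw [hY'] at hY ⊢
      have := Real.sin_nonneg_of_nonneg_of_le_pi h hY
      rw [abs_of_nonneg (by positivity)]
    · have hY' := abs_of_nonpos h
      rw [hY'] at hY ⊢
      have h3 := Real.sin_nonpos_of_nonpos_of_neg_pi_le h (by linarith)
      have h4 : Real.exp X * Real.sin Y ≤ 0 :=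
        mul_nonpos_of_nonneg_of_nonpos (Real.exp_pos X).le h3
      rw [abs_of_nonpos (by linarith), Real.sin_neg]
      ring
  rw [← habs] at h2 ⊢
  rw [← Real.cos_abs Y] at h1 ⊢
  exact lambert_bounds_of_nonneg (abs_nonneg Y) hY h1 h2

/-- The value of the principal branch on the circle of radius `1 / e`: functional equation of its
logarithm and distance to the branch point. -/
theorem lambertW_circle {θ : ℝ} (h0 : 0 < θ) (h2 : θ < 2 * Real.pi) :
    ∃ L : ℂ, Complex.exp L = lambertW (-Complex.exp (θ * Complex.I - 1)) ∧
      L = Complex.log (lambertW (-Complex.exp (θ * Complex.I - 1))) ∧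
      L + Complex.exp L + 1 = ((θ - Real.pi : ℝ) : ℂ) * Complex.I ∧
      L.re < 0 ∧ -2 ≤ L.re ∧ Real.pi - |θ - Real.pi| ≤ 34 * Real.pi * L.re ^ 2 ∧
      ‖1 + Complex.exp L‖ ≤ 5 * (-L.re) := by
  -- Existence suffices: the estimates below hold for any solution in the range.
  obtain ⟨hw, he⟩ := Classical.epsilon_spec (exists_mem_lambertWRange h0 h2)
  change lambertW (-Complex.exp (θ * Complex.I - 1)) ∈ lambertWRange at hw
  change lambertW (-Complex.exp (θ * Complex.I - 1))
    * Complex.exp (lambertW (-Complex.exp (θ * Complex.I - 1)))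
      = -Complex.exp (θ * Complex.I - 1) at he
  set w := lambertW (-Complex.exp (θ * Complex.I - 1)) with hwdef
  have hw0 : w ≠ 0 := by
    intro h
    rw [h, zero_mul] at he
    exact neg_ne_zero.2 (Complex.exp_ne_zero _) he.symm
  set L := Complex.log w with hL
  have hexp : Complex.exp L = w := Complex.exp_log hw0
  have hpi := Real.pi_pos
  have hlog := log_mul_exp_of_mem_lambertWRange hw hw0
  have harg : -Complex.exp (θ * Complex.I - 1)
      = Complex.exp (((θ - Real.pi : ℝ) : ℂ) * Complex.I - 1) := by
    have e : ((θ - Real.pi : ℝ) : ℂ) * Complex.I - 1 = (θ * Complex.I - 1) - Real.pi * Complex.I := by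
      push_cast
      ring
    rw [e, Complex.exp_sub _ (Real.pi * Complex.I), Complex.exp_pi_mul_I, div_neg, div_one]
  rw [he, harg, Complex.log_exp (by simp; linarith) (by simp; linarith), ← hL] at hlog
  have heq : L + Complex.exp L + 1 = ((θ - Real.pi : ℝ) : ℂ) * Complex.I := by
    rw [hexp, ← hlog]
    ring
  have hre := congrArg Complex.re heq
  have him := congrArg Complex.im heq
  rw [Complex.add_re, Complex.add_re, Complex.exp_re, Complex.one_re, Complex.re_ofReal_mul,
    Complex.I_re, mul_zero] at hre
  rw [Complex.add_im, Complex.add_im, Complex.exp_im, Complex.one_im, Complex.im_ofReal_mul,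
    Complex.I_im, mul_one, add_zero] at him
  have hb := lambert_bounds (X := L.re) (Y := L.im)
    (abs_le.2 ⟨(Complex.neg_pi_lt_log_im w).le, Complex.log_im_le_pi w⟩) (by linarith)
    (by rw [him, abs_lt]; constructor <;> linarith)
  rw [him] at hb
  obtain ⟨b1, b2, b3, b4⟩ := hb
  refine ⟨L, hexp, rfl, heq, b1, b2, b4, ?_⟩
  have hsq : ‖1 + Complex.exp L‖ ^ 2
      = (1 - Real.exp L.re) ^ 2 + 2 * Real.exp L.re * (1 + Real.cos L.im) := by
    rw [← Complex.normSq_eq_norm_sq, Complex.normSq_apply, Complex.add_re, Complex.add_im,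
      Complex.exp_re, Complex.exp_im, Complex.one_re, Complex.one_im]
    linear_combination Real.exp L.re ^ 2 * Real.sin_sq_add_cos_sq L.im
  have he1 : Real.exp L.re ≤ 1 := Real.exp_le_one_iff.2 b1.le
  have he0 := Real.exp_pos L.re
  have he2 := Real.add_one_le_exp L.re
  have hle : ‖1 + Complex.exp L‖ ^ 2 ≤ (5 * (-L.re)) ^ 2 := by
    rw [hsq]
    have h3 : (1 - Real.exp L.re) ^ 2 ≤ L.re ^ 2 := by nlinarith
    have h4 : 0 ≤ 1 + Real.cos L.im := by linarith [Real.neg_one_le_cos L.im]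
    nlinarith
  exact le_of_sq_le_sq hle (by linarith)

/-! ### Distance from the zeros to the Szegő curve -/

/-- Convexity bounds |exp| on the segment by the chord from exp(Re a) to 1, whose mean is the stated
factor. It stays below 1 when Re a < 0, even if b lies on the imaginary axis. -/
theorem norm_exp_sub_exp_le {a b : ℂ} (hb : b.re ≤ 0) :
    ‖Complex.exp b - Complex.exp a‖ ≤ ‖b - a‖ * ((1 + Real.exp a.re) / 2) := by
  set d := b - a with hd
  have hF' : ∀ t : ℝ, HasDerivAt (fun t : ℝ => Complex.exp (a + t * d) - Complex.exp a)
      (Complex.exp (a + t * d) * d) t := by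
    intro t
    have h0 : HasDerivAt (fun t : ℝ => a + (t : ℂ) * d) d t := by
      simpa using ((Complex.ofRealCLM.hasDerivAt (x := t)).mul_const d).const_add a
    exact h0.cexp.sub_const _
  have hB' : ∀ t : ℝ, HasDerivAt
      (fun t : ℝ => ‖d‖ * (Real.exp a.re * t + (1 - Real.exp a.re) * (t ^ 2 / 2)))
      (‖d‖ * ((1 - t) * Real.exp a.re + t * 1)) t := by
    intro t
    have h := (((hasDerivAt_id t).const_mul (Real.exp a.re)).add
      (((hasDerivAt_pow 2 t).div_const 2).const_mul (1 - Real.exp a.re))).const_mul ‖d‖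
    refine h.congr_deriv ?_
    push_cast
    ring
  have hbound : ∀ t ∈ Set.Ico (0 : ℝ) 1, ‖Complex.exp (a + t * d) * d‖
      ≤ ‖d‖ * ((1 - t) * Real.exp a.re + t * 1) := by
    intro t ht
    have e : (a + t * d).re = (1 - t) * a.re + t * b.re := by
      simp [hd]
      ring
    have hconv := convexOn_exp.2 (Set.mem_univ a.re) (Set.mem_univ b.re)
      (by linarith [ht.2] : 0 ≤ 1 - t) ht.1 (by ring)
    simp only [smul_eq_mul] at hconv
    rw [norm_mul, Complex.norm_exp, e, mul_comm]
    have h1 : Real.exp b.re ≤ 1 := Real.exp_le_one_iff.2 hb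
    have h2 : t * Real.exp b.re ≤ t * 1 := mul_le_mul_of_nonneg_left h1 ht.1
    gcongr
    linarith
  have h := image_norm_le_of_norm_deriv_right_le_deriv_boundary (a := 0) (b := 1)
    (fun t _ => (hF' t).continuousAt.continuousWithinAt) (fun t _ => (hF' t).hasDerivWithinAt)
    (by simp) hB' hbound (Set.right_mem_Icc.2 zero_le_one)
  have e : a + ((1 : ℝ) : ℂ) * d = b := by rw [hd]; simp
  rw [e] at h
  refine h.trans_eq ?_
  ring

/-- The Stirling sequence decreases from its first term, so n! ≤ e √n (n/e)^n. -/
theorem sqrt_div_exp_le_remainderCoeff {n : ℕ} (hn : 0 < n) :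
    √(n : ℝ) / Real.exp 1 ≤ remainderCoeff n * Real.exp (-n) := by
  have h1 : Stirling.stirlingSeq n ≤ Stirling.stirlingSeq 1 := by
    obtain ⟨k, rfl⟩ := Nat.exists_eq_succ_of_ne_zero hn.ne'
    exact Stirling.stirlingSeq'_antitone (Nat.zero_le k)
  have hn' : (0 : ℝ) < n := by exact_mod_cast hn
  have hs : √(n : ℝ) * √n = n := Real.mul_self_sqrt hn'.le
  have hs0 : 0 < √(n : ℝ) := Real.sqrt_pos.2 hn'
  rw [Stirling.stirlingSeq_one, Stirling.stirlingSeq, Real.sqrt_mul (by norm_num),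
    div_pow, ← Real.exp_nat_mul, mul_one, div_le_div_iff₀ (by positivity) (by positivity)] at h1
  have h2 : (n.factorial : ℝ) ≤ Real.exp 1 * (√n * (n ^ n / Real.exp n)) := by
    have : 0 < √(2 : ℝ) := by positivity
    nlinarith
  rw [remainderCoeff, Real.exp_neg, ← div_eq_mul_inv, div_div,
    div_le_div_iff₀ (Real.exp_pos 1) (by positivity)]
  calc √(n : ℝ) * (n.factorial * Real.exp n)
      ≤ √(n : ℝ) * (Real.exp 1 * (√n * (n ^ n / Real.exp n)) * Real.exp n) := by gcongr
    _ = (√(n : ℝ) * √n) * n ^ n * Real.exp 1 * (Real.exp n / Real.exp n) := by ring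
    _ = _ := by rw [hs, div_self (Real.exp_pos _).ne', pow_succ]; ring

/-- The error terms in the phase are at most logarithmic in `√n * ‖1 - exp l‖`. -/
theorem norm_phase_error_le {n : ℕ} (hn : 0 < n) {l : ℂ} (hl : l.re ≤ 0) (h0 : 0 < l.im)
    (h2 : l.im < 2 * Real.pi) (hre : (remainderPhase n l).re = 0) :
    ‖l + ((Real.log (remainderCoeff n) - n : ℝ) : ℂ) + Complex.log (normRemainder n l)‖
      ≤ 17 + Real.log (2 + √n * ‖1 - Complex.exp l‖) := by
  have hc := remainderCoeff_pos hn
  have hG : 0 < ‖normRemainder n l‖ := norm_pos_iff.2 (normRemainder_ne_zero hn hl)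
  have hn1 : (1 : ℝ) ≤ n := by exact_mod_cast hn
  have hs : √(n : ℝ) * √n = n := Real.mul_self_sqrt (by linarith)
  have hs1 : 1 ≤ √(n : ℝ) := Real.one_le_sqrt.2 hn1
  have hpi := Real.pi_lt_d2
  set u := Real.log (remainderCoeff n) - n + Real.log ‖normRemainder n l‖ with hu
  have hu_exp : Real.exp u = remainderCoeff n * Real.exp (-n) * ‖normRemainder n l‖ := by
    rw [hu, Real.exp_add, sub_eq_add_neg, Real.exp_add, Real.exp_log hc, Real.exp_log hG]
  have hu0 : u ≤ 0 := by
    rw [← Real.exp_le_one_iff, hu_exp]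
    have h := norm_normRemainder_le hn hl
    calc _ ≤ remainderCoeff n * Real.exp (-n) * (Real.exp n / remainderCoeff n) := by gcongr
      _ = Real.exp (-n) * Real.exp n := by field_simp
      _ = 1 := by rw [← Real.exp_add]; simp
  have hu1 : -(4 + Real.log (2 + √n * ‖1 - Complex.exp l‖)) ≤ u := by
    have hpos : 0 < 2 + √n * ‖1 - Complex.exp l‖ := by positivity
    rw [← Real.exp_le_exp, hu_exp, Real.exp_neg, Real.exp_add, Real.exp_log hpos]
    have h16 : 16 * Real.exp 1 ≤ Real.exp 4 := by
      have e : Real.exp 4 = Real.exp 1 * Real.exp 1 * Real.exp 1 * Real.exp 1 := by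
        rw [← Real.exp_add, ← Real.exp_add, ← Real.exp_add]; norm_num
      have h27 := Real.exp_one_gt_d9
      have h7 : 7 ≤ Real.exp 1 * Real.exp 1 := by nlinarith
      have h18 : 16 ≤ Real.exp 1 * Real.exp 1 * Real.exp 1 := by nlinarith
      rw [e]
      exact mul_le_mul_of_nonneg_right h18 (by linarith)
    have h := le_norm_normRemainder hn hl
    have hM : 1 + √n + n * ‖1 - Complex.exp l‖ ≤ √n * (2 + √n * ‖1 - Complex.exp l‖) := by
      rw [mul_add, ← mul_assoc, hs]
      linarith
    calc (Real.exp 4 * (2 + √n * ‖1 - Complex.exp l‖))⁻¹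
        ≤ (16 * Real.exp 1 * (2 + √n * ‖1 - Complex.exp l‖))⁻¹ := by gcongr
      _ = √n / Real.exp 1 * (1 / (16 * (√n * (2 + √n * ‖1 - Complex.exp l‖)))) := by field_simp
      _ ≤ √n / Real.exp 1 * (1 / (16 * (1 + √n + n * ‖1 - Complex.exp l‖))) := by gcongr
      _ ≤ remainderCoeff n * Real.exp (-n) * ‖normRemainder n l‖ := by
          have := sqrt_div_exp_le_remainderCoeff hn
          gcongr
  -- If Re l < -2, the real part of the phase would be negative, as `u` ≤ 0.
  have hx : -2 ≤ l.re := by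
    have h3 : n * (l.re - Real.exp l.re * Real.cos l.im) + n + l.re + u = 0 := by
      rw [← hre, remainderPhase, Complex.add_re, Complex.add_re, Complex.add_re, Complex.log_re,
        Complex.ofReal_re, ← Complex.ofReal_natCast, Complex.re_ofReal_mul, Complex.sub_re,
        Complex.exp_re, hu]
      ring
    have h4 : -1 ≤ Real.exp l.re * Real.cos l.im := by
      have := Real.exp_le_one_iff.2 hl
      nlinarith [Real.neg_one_le_cos l.im, Real.exp_pos l.re]
    by_contra! hlt
    nlinarith
  have hl_norm : ‖l‖ ≤ 2 + 2 * Real.pi := by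
    refine (Complex.norm_le_abs_re_add_abs_im l).trans ?_
    rw [abs_of_nonpos hl, abs_of_pos h0]
    linarith
  have hlog : ((Real.log (remainderCoeff n) - n : ℝ) : ℂ) + Complex.log (normRemainder n l)
      = (u : ℂ) + ((normRemainder n l).arg : ℂ) * Complex.I := by
    rw [Complex.log, hu]
    push_cast
    ring
  have harg : ‖((normRemainder n l).arg : ℂ) * Complex.I‖ ≤ Real.pi := by
    rw [norm_mul, Complex.norm_I, mul_one, Complex.norm_real]
    exact Complex.abs_arg_le_pi _
  have hun : ‖(u : ℂ)‖ ≤ 4 + Real.log (2 + √n * ‖1 - Complex.exp l‖) := by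
    rw [Complex.norm_real, Real.norm_of_nonpos hu0]
    linarith
  rw [add_assoc, hlog, ← add_assoc]
  refine norm_add₃_le.trans ?_
  linarith

theorem mul_le_of_mul_le_log {b X : ℝ} (hb : 1 / 6 ≤ b) (hX : 0 ≤ X)
    (h : b * X / 6 ≤ 21 + Real.log (2 + 5 * b + X)) : X ≤ 2000 := by
  have hpos : 0 < 2 + 5 * b + X := by linarith
  have h1 : Real.log (2 + 5 * b + X) ≤ (2 + 5 * b + X) / 72 + 5 := by
    -- The scale 72 makes X/72 ≤ bX/12, half of the left side of `h`, since b ≥ 1/6.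
    have h2 := Real.log_le_sub_one_of_pos (show 0 < (2 + 5 * b + X) / 72 by positivity)
    rw [Real.log_div hpos.ne' (by norm_num)] at h2
    have h3 : Real.log 72 ≤ 6 := by
      rw [Real.log_le_iff_le_exp (by norm_num)]
      have e : Real.exp 6 = Real.exp 1 ^ 6 := by rw [← Real.exp_nat_mul]; norm_num
      rw [e]
      calc (72 : ℝ) ≤ 2.7 ^ 6 := by norm_num
        _ ≤ _ := by
          have := Real.exp_one_gt_d9
          gcongr
          linarith
    linarith
  by_contra! hlt
  nlinarith

/-- A zero of the truncated exponential differs from the corresponding point of the Szegő curve by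
at most a multiple of `1 / √n`, in logarithmic coordinates. -/
theorem sqrt_mul_norm_sub_le {n t : ℕ} (hn : 0 < n) (ht : t ∈ Finset.Icc 1 n) {l L : ℂ} {θ : ℝ}
    (hθ : n * θ = 2 * Real.pi * (t - 1 / 2))
    (hl : l.re ≤ 0) (h0 : 0 < l.im) (h2 : l.im < 2 * Real.pi)
    (hph : remainderPhase n l = t * (2 * Real.pi * Complex.I))
    (hL : L + Complex.exp L + 1 = ((θ - Real.pi : ℝ) : ℂ) * Complex.I)
    (hL0 : L.re < 0) (hL2 : -2 ≤ L.re) (hLθ : Real.pi - |θ - Real.pi| ≤ 34 * Real.pi * L.re ^ 2)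
    (hL1 : ‖1 + Complex.exp L‖ ≤ 5 * (-L.re)) :
    √n * ‖l - (L + Real.pi * Complex.I)‖ ≤ 2000 := by
  have hn0 : (0 : ℝ) < n := by exact_mod_cast hn
  have hs : √(n : ℝ) * √n = n := Real.mul_self_sqrt hn0.le
  have hs0 : 0 < √(n : ℝ) := Real.sqrt_pos.2 hn0
  have hpi := Real.pi_pos
  have hpi' := Real.pi_lt_d2
  rw [Finset.mem_Icc] at ht
  have ht1 : (1 : ℝ) ≤ t := by exact_mod_cast ht.1
  have htn : (t : ℝ) ≤ n := by exact_mod_cast ht.2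
  set S := L + Real.pi * Complex.I with hS
  have hSre : S.re = L.re := by simp [hS]
  have hSexp : Complex.exp S = -Complex.exp L := by
    rw [hS, Complex.exp_add, Complex.exp_pi_mul_I, mul_neg_one]
  set B := -L.re with hB
  have hB0 : 0 < B := by linarith
  have hb : 1 / 6 ≤ √n * B := by
    -- The half-integer shift keeps θ at distance at least π/n from 0 and 2π, the angles of the
    -- branch point.
    have h3 : Real.pi ≤ n * (Real.pi - |θ - Real.pi|) := by
      have h4 : n * |θ - Real.pi| ≤ n * Real.pi - Real.pi := by
        rw [← abs_of_pos hn0, ← abs_mul, abs_of_pos hn0, abs_le]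
        constructor <;> nlinarith
      linarith
    have h5 : n * (Real.pi - |θ - Real.pi|) ≤ n * (34 * Real.pi * L.re ^ 2) := by gcongr
    have h6 : 1 ≤ 34 * (√n * B) ^ 2 := by
      have e : n * (34 * Real.pi * L.re ^ 2) = 34 * (√n * B) ^ 2 * Real.pi := by
        rw [hB, mul_pow, pow_two √(n : ℝ), hs]
        ring
      rw [e] at h5
      exact le_of_mul_le_mul_right (by linarith) hpi
    have h7 : 0 < √n * B := by positivity
    nlinarith
  set D := ‖l - S‖ with hD
  have hexp := norm_exp_sub_exp_le (a := S) hl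
  rw [hSre] at hexp
  have hclose : ‖1 - Complex.exp l‖ ≤ 5 * B + D := by
    have e : 1 - Complex.exp l = (1 + Complex.exp L) - (Complex.exp l - Complex.exp S) := by
      rw [hSexp]
      ring
    have h3 : ‖Complex.exp l - Complex.exp S‖ ≤ D := by
      refine hexp.trans (mul_le_of_le_one_right (norm_nonneg _) ?_)
      linarith [Real.exp_le_one_iff.2 hL0.le]
    rw [e]
    exact (norm_sub_le _ _).trans (by linarith)
  have hlower : D * (B / 6) ≤ ‖(l - Complex.exp l) - (S - Complex.exp S)‖ := by
    have e : (l - Complex.exp l) - (S - Complex.exp S) = (l - S) - (Complex.exp l - Complex.exp S) := by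
      ring
    have h3 : B / 3 ≤ 1 - Real.exp L.re := by
      have h4 : Real.exp L.re * Real.exp B = 1 := by rw [hB, ← Real.exp_add]; simp
      have h5 := Real.add_one_le_exp B
      have h6 := Real.exp_pos L.re
      have h7 : Real.exp L.re * (B + 1) ≤ 1 := by nlinarith
      nlinarith
    rw [e]
    have h4 := norm_sub_norm_le (l - S) (Complex.exp l - Complex.exp S)
    have h5 : D * (B / 6) ≤ D - D * ((1 + Real.exp L.re) / 2) := by
      have : 0 ≤ D := norm_nonneg _
      nlinarith
    linarith
  have hupper : n * ‖(l - Complex.exp l) - (S - Complex.exp S)‖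
      ≤ 21 + Real.log (2 + √n * ‖1 - Complex.exp l‖) := by
    have hre : (remainderPhase n l).re = 0 := by
      rw [hph]
      simp
    -- The term πi is the gap between the levels 2πit and 2πi(t - 1/2).
    have e : (n : ℂ) * ((l - Complex.exp l) - (S - Complex.exp S)) = Real.pi * Complex.I
        - (l + ((Real.log (remainderCoeff n) - n : ℝ) : ℂ) + Complex.log (normRemainder n l)) := by
      have h3 : S - Complex.exp S = (θ : ℂ) * Complex.I - 1 := by
        rw [hSexp, hS]
        push_cast at hL
        linear_combination hL
      have h4 : (n : ℂ) * θ = 2 * Real.pi * (t - 1 / 2) := by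
        have := congrArg (fun x : ℝ => (x : ℂ)) hθ
        push_cast at this
        exact this
      rw [remainderPhase] at hph
      rw [h3]
      push_cast
      linear_combination hph - Complex.I * h4
    have h5 : (n : ℝ) * ‖(l - Complex.exp l) - (S - Complex.exp S)‖
        = ‖(n : ℂ) * ((l - Complex.exp l) - (S - Complex.exp S))‖ := by
      rw [norm_mul, Complex.norm_natCast]
    rw [h5, e]
    refine (norm_sub_le _ _).trans ?_
    have h6 := norm_phase_error_le hn hl h0 h2 hre
    have h7 : ‖(Real.pi : ℂ) * Complex.I‖ = Real.pi := by
      rw [norm_mul, Complex.norm_I, mul_one, Complex.norm_real, Real.norm_of_nonneg hpi.le]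
    linarith
  apply mul_le_of_mul_le_log hb (by positivity)
  calc √n * B * (√n * D) / 6 = (√n * √n) * (D * (B / 6)) := by ring
    _ ≤ n * ‖(l - Complex.exp l) - (S - Complex.exp S)‖ := by rw [hs]; gcongr
    _ ≤ _ := hupper
    _ ≤ 21 + Real.log (2 + 5 * (√n * B) + √n * D) := by
      have h3 : √n * ‖1 - Complex.exp l‖ ≤ √n * (5 * B + D) := by gcongr
      apply add_le_add_right
      apply Real.log_le_log (by positivity)
      linarith

theorem exists_shifted_log_lambertW {n : ℕ} (hn : 0 < n) {t : ℕ} (ht : t ∈ Finset.Icc 1 n) {l : ℂ}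
    (hl : l.re ≤ 0) (h0 : 0 < l.im) (h2 : l.im < 2 * Real.pi)
    (hph : remainderPhase n l = t * (2 * Real.pi * Complex.I)) :
    ∃ δ : ℂ, √n * ‖δ‖ ≤ 2000 ∧
      lambertW (-Complex.exp (2 * Real.pi * Complex.I * (t - 1 / 2) / n - 1)) ≠ 0 ∧
      Complex.exp (-Complex.log
        (lambertW (-Complex.exp (2 * Real.pi * Complex.I * (t - 1 / 2) / n - 1))) + δ)
          = -(Complex.exp l)⁻¹ := by
  have hn0 : (0 : ℝ) < n := by exact_mod_cast hn
  have hpi := Real.pi_pos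
  have ht' := Finset.mem_Icc.1 ht
  have ht1 : (1 : ℝ) ≤ t := by exact_mod_cast ht'.1
  have htn : (t : ℝ) ≤ n := by exact_mod_cast ht'.2
  set θ : ℝ := 2 * Real.pi * (t - 1 / 2) / n with hθ
  have hnθ : n * θ = 2 * Real.pi * (t - 1 / 2) := by
    rw [hθ]
    field_simp
  have hθ0 : 0 < θ := by
    have : (0 : ℝ) < t - 1 / 2 := by linarith
    positivity
  have hθ2 : θ < 2 * Real.pi := by
    rw [hθ, div_lt_iff₀ hn0]
    apply mul_lt_mul_of_pos_left _ (by linarith)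
    linarith
  have harg : 2 * Real.pi * Complex.I * (t - 1 / 2) / n - 1 = (θ : ℂ) * Complex.I - 1 := by
    rw [hθ]
    push_cast
    ring
  obtain ⟨L, hexp, hlog, hfun, b1, b2, b3, b4⟩ := lambertW_circle hθ0 hθ2
  rw [harg, ← hlog, ← hexp]
  -- The witness is S - l; the shift πi produces the sign in -1/z.
  refine ⟨L + Real.pi * Complex.I - l, ?_, Complex.exp_ne_zero L, ?_⟩
  · rw [norm_sub_rev]
    exact sqrt_mul_norm_sub_le hn ht hnθ hl h0 h2 hph hfun b1 b2 b3 b4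
  · rw [show -L + (L + Real.pi * Complex.I - l) = Real.pi * Complex.I - l by ring, Complex.exp_sub,
      Complex.exp_pi_mul_I, neg_div, one_div]

theorem norm_exp_div_sub_one_le {m n : ℕ} (hm : 0 < m) (hn : 0 < n) {δ : ℂ}
    (hδ : √n * ‖δ‖ ≤ 2000) :
    ‖Complex.exp (δ / m) - 1‖ ≤ 2000 * Real.exp 2000 * ((m * n : ℕ) : ℝ) ^ (-(1 / 2) : ℝ) := by
  have hm1 : (1 : ℝ) ≤ m := by exact_mod_cast hm
  have hn1 : (1 : ℝ) ≤ n := by exact_mod_cast hn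
  have hsn : 1 ≤ √(n : ℝ) := Real.one_le_sqrt.2 hn1
  have hsm : √(m : ℝ) ≤ m := by
    rw [Real.sqrt_le_left (by linarith)]
    nlinarith
  have hsm0 : 0 < √(m : ℝ) := Real.sqrt_pos.2 (by linarith)
  have hd : ‖δ‖ ≤ 2000 := by nlinarith [norm_nonneg δ]
  have hdm : ‖δ / m‖ = ‖δ‖ / m := by rw [norm_div, Complex.norm_natCast]
  have h := Complex.norm_exp_sub_sum_le_norm_mul_exp (δ / m) 1
  simp only [Finset.sum_range_one, pow_zero, Nat.factorial_zero, Nat.cast_one, div_one,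
    pow_one] at h
  have hpow : ((m * n : ℕ) : ℝ) ^ (-(1 / 2) : ℝ) = 1 / (√m * √n) := by
    rw [Real.rpow_neg (by positivity), ← Real.sqrt_eq_rpow, Nat.cast_mul,
      Real.sqrt_mul (by positivity), one_div]
  -- Since √m ≤ m, dividing by m gives more than the needed factor 1/√m.
  have h1 : ‖δ / m‖ ≤ 2000 * (1 / (√m * √n)) := by
    rw [hdm, mul_one_div, div_le_div_iff₀ (by linarith) (by positivity)]
    calc ‖δ‖ * (√m * √n) = √n * ‖δ‖ * √m := by ring
      _ ≤ 2000 * m := by gcongr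
  have h2 : Real.exp ‖δ / m‖ ≤ Real.exp 2000 := by
    rw [Real.exp_le_exp, hdm]
    exact (div_le_self (norm_nonneg _) hm1).trans hd
  rw [hpow]
  calc _ ≤ ‖δ / m‖ * Real.exp ‖δ / m‖ := h
    _ ≤ 2000 * (1 / (√m * √n)) * Real.exp 2000 := by gcongr
    _ = _ := by ring

theorem theorem1 :
    ∃ K : ℝ, 0 < K ∧
      ∀ (m N : ℕ), 0 < m → 0 < N → m ∣ N →
        ∀ C : Matrix.GeneralLinearGroup (Fin N) ℂ,
          (∀ q ∈ Finset.Icc 1 N,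
            ((C : Matrix (Fin N) (Fin N) ℂ) ^ q).trace = if q = m then (N : ℂ) else 0) →
          ∃ eig err : ℕ → ℕ → ℂ,
            (C : Matrix (Fin N) (Fin N) ℂ).charpoly.roots =
              (Finset.Icc 1 (N / m) ×ˢ Finset.Icc 1 m).val.map (fun p => eig p.1 p.2) ∧
            ∀ t ∈ Finset.Icc 1 (N / m), ∀ s ∈ Finset.Icc 1 m,
              eig t s = approxEigenvalue m N t s * (1 + err t s) ∧
              ‖err t s‖ ≤ K * (N : ℝ) ^ (-(1 / 2) : ℝ) := by
  refine ⟨2000 * Real.exp 2000, by positivity, ?_⟩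
  rintro m N hm hN ⟨n, rfl⟩ C hC
  have hn : 0 < n := Nat.pos_of_mul_pos_left hN
  have hmC : (m : ℂ) ≠ 0 := by exact_mod_cast hm.ne'
  have hnC : (n : ℂ) ≠ 0 := by exact_mod_cast hn.ne'
  rw [Nat.mul_div_cancel_left n hm]
  obtain ⟨l, hl, hprod⟩ := exists_revTruncExp_eq_prod hn
  have hδ := fun t ht => exists_shifted_log_lambertW hn ht (hl t ht).1 (hl t ht).2.1
    (hl t ht).2.2.1 (hl t ht).2.2.2
  choose! δ hδ1 hδ2 hδ3 using hδ
  set w : ℕ → ℂ := fun t =>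
    lambertW (-Complex.exp (2 * Real.pi * Complex.I * (t - 1 / 2) / n - 1)) with hw
  have happrox : ∀ t ∈ Finset.Icc 1 n, ∀ s : ℕ, approxEigenvalue m (m * n) t s
      = Complex.exp (2 * Real.pi * Complex.I * s / m) * Complex.exp (-Complex.log (w t) / m) := by
    intro t ht s
    have e : 2 * Real.pi * Complex.I * m * (t - 1 / 2) / ((m * n : ℕ) : ℂ) - 1
        = 2 * Real.pi * Complex.I * (t - 1 / 2) / n - 1 := by
      push_cast
      field_simp
    rw [approxEigenvalue, e, Complex.cpow_def_of_ne_zero (hδ2 t ht)]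
    congr 2
    ring
  -- These are the m-th roots of exp(-log W + δ), the t-th root of `revTruncExp`; the factor
  -- exp(δ/m) is the relative error.
  refine ⟨fun t s => Complex.exp (2 * Real.pi * Complex.I * s / m)
      * Complex.exp ((-Complex.log (w t) + δ t) / m),
    fun t s => Complex.exp (δ t / m) - 1, ?_, ?_⟩
  · have hchar : (C : Matrix (Fin (m * n)) (Fin (m * n)) ℂ).charpoly
        = (((Finset.Icc 1 n ×ˢ Finset.Icc 1 m).val.map fun p : ℕ × ℕ =>
          Complex.exp (2 * Real.pi * Complex.I * p.2 / m)
            * Complex.exp ((-Complex.log (w p.1) + δ p.1) / m)).map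
          fun a => Polynomial.X - Polynomial.C a).prod := by
      rw [Matrix.charpoly_of_trace_pow_eq_ite hm _ hC, Multiset.map_map]
      change (revTruncExp n).comp (Polynomial.X ^ m) = ∏ p ∈ Finset.Icc 1 n ×ˢ Finset.Icc 1 m,
        (Polynomial.X - Polynomial.C (Complex.exp (2 * Real.pi * Complex.I * p.2 / m)
            * Complex.exp ((-Complex.log (w p.1) + δ p.1) / m)))
      rw [hprod, Polynomial.prod_comp, Finset.prod_product]
      apply Finset.prod_congr rfl
      intro t ht
      have h := Polynomial.X_pow_sub_C_pow_eq_prod_Icc hm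
        (Complex.exp ((-Complex.log (w t) + δ t) / m))
      rw [← Complex.exp_nat_mul, mul_div_cancel₀ _ hmC] at h
      rw [Polynomial.sub_comp, Polynomial.X_comp, Polynomial.C_comp, ← hδ3 t ht]
      exact h
    rw [hchar, Polynomial.roots_multiset_prod_X_sub_C]
  · intro t ht s _
    refine ⟨?_, norm_exp_div_sub_one_le hm hn (hδ1 t ht)⟩
    dsimp only
    rw [happrox t ht, add_sub_cancel, add_div, Complex.exp_add, ← mul_assoc]
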